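/- **Setting.** Let $\mathcal G=(G,H,t,\alpha)$ be a Lie crossed module: $G,H$ are Lie groups, $t:H\to G$ and $\alpha:G\to\mathrm{Aut}(H)$ are smooth homomorphisms with $t(\alpha_g(h))=g\,t(h)g^{-1}$ and $\alpha_{t(h)}(h')=hh'h^{-1}$. View $\mathcal G$ as a category with objects $G$, arrows $H\rtimes G$, where $(h,g)(h',g')=(h\alpha_g(h'),gg')$, source $s(h,g)=g$ and target $t(h,g)=t(h)g$. Let $\mathfrak g,\mathfrak h$ be the Lie algebras, $t^{Lie}:\mathfrak h\to\mathfrak g$ the derivative of $t$, and write $\alpha_g$ also for the induced automorphism of $\mathfrak h$. The Lie algebra of $H\rtimes G$ is $\mathfrak h\oplus\mathfrak g$ as a vector space. For $h\in H$ and $Y\in\mathfrak g$ let $h^{-1}\alpha^{Lie}_Y(h)\in\mathfrak h$ be the derivative at $1$, in the direction $Y$, of $g\mapsto h^{-1}\alpha_g(h)$. For an element $k$ of a Lie group, $k^{-1}Zk$ denotes $\mathrm{Ad}(k^{-1})Z$. Let $\mathcal M$ be an affine 2-space: a category with a manifold $M$ of objects and a manifold of arrows and with smooth structure maps, a reflexive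 symmetric relation $\mathcal R$ on $M$, and a map sending each finite sequence $(x_n,\dots,x_1)$, $x_{k+1}\mathcal R x_k$, to an arrow $\overleftarrow{x_n\cdots x_1}$ from $x_1$ to $x_n$, such that $\overleftarrow{x}=\mathrm{id}_x$, consecutive repetitions can be deleted, concatenation corresponds to composition, every arrow is obtained, and the representing sequence of minimal length is unique. The set $M^2_{/\mathcal R}$ of pairs $(y,x)$ with $y\mathcal R x$ is a manifold immersed in $M\times M$, such that $x\mapsto(x,x)$ and $(y,x)\mapsto\overleftarrow{yx}$ are smooth; $d_{(2)}=d_x+d_y$ is its exterior differential. Let $\{U^i\}$ be a cover of $M$ by contractible open sets; $\mathcal U^i$ has objects $U^i$ and the arrows $\overleftarrow{x_n\cdots x_1}$ with all $x_k\in U^i$. Let $\mathcal P$ be a principal 2-bundle over $\mathcal M$: a category with a functor $\pi:\mathcal P\to\mathcal M$ surjective on objects and arrows, and, for each $i$, functors $\phi^i:\mathcal U^i\times\mathcal G\to\pi^{-1}(\mathcal U^i)$ and $\bar\phi^i:\pi^{-1}(\mathcal U^i)\to\mathcal U^i\times\mathcal G$ with natural equivalences $\kappa^i:\mathrm{id}\to\bar\phi^i\phi^i$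 and $\bar\kappa^i:\mathrm{id}\to\phi^i\bar\phi^i$, such that $\mathrm{Pr}_1\bar\phi^i=\pi$ and $\bar\phi^i\phi^i(x,g)g'=\bar\phi^i\phi^i(x,gg')$ on objects. Let $g^{ij}(x)\in G$ and $h^{ij}(y,x)\in H$ be its smooth transition functions: $\bar\phi^i\phi^j(x,g)=(x,g^{ij}(x)g)$ and $\bar\phi^i\phi^j(f,h,g)=(f,q^{ij}(y,x)(h,g))$ with $q^{ij}(y,x)=(h^{ij}(y,x),g^{ij}(x))\in H\rtimes G$, for every arrow $f$ from $x$ to $y$ of $\mathcal U^i\cap\mathcal U^j$ (the open sub-2-space with set of objects $U^i\cap U^j$). Its 2-transition functions $h^{ijk}(x)\in H$ are given by $\bar\phi^i(\bar\kappa^j_{\phi^k(x,1)})=(\mathrm{id}_x,h^{ijk}(x)^{-1},g^{ik}(x))$; $\mathcal P$ is *trivial* if $h^{ijk}=1$ for all $i,j,k$. Let $P^i=\{\phi^i(x,g)\}\simeq U^i\times G$ and $Q^i=\{\phi^i(\overleftarrow{yx},h,g)\}\simeq (U^i)^2_{/\mathcal R}\times(H\rtimes G)$. Connections on $P^i$ and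 $Q^i$ (with connection 1-forms $\omega^i_P$, $\omega^i_Q$) are called *compatible* if $\phi^i(x,g)\mapsto\phi^i(\overleftarrow{xx},1,g)$ sends horizontal vectors to horizontal vectors, and $\phi^i(\overleftarrow{yx},h,g)\mapsto\phi^i(x,g)$ and $\phi^i(\overleftarrow{yx},h,g)\mapsto\phi^i(y,t(h)g)$ map horizontal spaces onto horizontal spaces. The gauge potentials $A^i\in\Omega^1(U^i,\mathfrak g)$ and $\underline\eta^i\in\Omega^1((U^i)^2_{/\mathcal R},\mathfrak h\oplus\mathfrak g)$ are the pull-backs of $\omega_P^i$ and $\omega_Q^i$ by $x\mapsto\phi^i(x,1)$ and $(y,x)\mapsto\phi^i(\overleftarrow{yx},1,1)$, and $\eta^i$ is the $\mathfrak h$-component of $\underline\eta^i$. For a form $\theta$ on an open subset of $M$, $\theta(x)$ and $\theta(y)$ denote its pull-backs by $(y,x)\mapsto x$ and $(y,x)\mapsto y$. **(1) Trivial 2-bundles.** Let $\mathcal P$ be trivial and let a 2-connection on it be given: a connection on the principal $G$-bundle $P$ over $M$ with transition functions $g^{ij}$ and a connection on the principal $H\rtimes G$-bundle $Q$ over $\bigcup_i(U^i)^2_{/\mathcal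 R}$ with transition functions $q^{ij}$, whose restrictions to the $P^i$ and $Q^i$ are compatible. Then $\underline\eta^i(y,x)=A^i(x)+\eta^i(y,x)$ on $(U^i)^2_{/\mathcal R}$, and on $(U^i\cap U^j)^2_{/\mathcal R}$ $$\alpha_{g^{ij}(x)}(\eta^j(y,x))=h^{ij}(y,x)^{-1}\eta^i(y,x)h^{ij}(y,x)+h^{ij}(y,x)^{-1}d_{(2)}h^{ij}(y,x)+h^{ij}(y,x)^{-1}\alpha^{Lie}_{A^i(x)}(h^{ij}(y,x)).$$ **(2) General case.** Assume that $G/t(H)$ is a quotient Lie group of $G$. For a general $\mathcal P$, let a 2-connection be given: compatible connections on the $P^i$ and $Q^i$, and a connection on the principal $G/t(H)$-bundle $R$ over $M$ whose transition functions are the classes of the $g^{ij}$, such that the projections $P^i\to P^i/t(H)\simeq R_{|U^i}$ map horizontal spaces onto horizontal spaces. Let $\eta^{ij}\in\Omega^1(U^i\cap U^j,\mathfrak h)$ be a potential-transformation, i.e. $A^j=(g^{ij})^{-1}A^ig^{ij}+(g^{ij})^{-1}dg^{ij}+t^{Lie}(\eta^{ij})$. Then on $(U^i\cap U^j)^2_{/\mathcal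 R}$ $$\underline\eta^j(y,x)=q^{ij}(y,x)^{-1}\underline\eta^i(y,x)q^{ij}(y,x)+q^{ij}(y,x)^{-1}d_{(2)}q^{ij}(y,x)+t^{Lie}(\eta^{ij}(x))+\eta^{ij}(y)-\eta^{ij}(x)$$ modulo $\ker t^{Lie}$: the two sides differ by an $\mathfrak h$-valued 1-form with values in $\ker t^{Lie}$ which vanishes when pulled back to the diagonal by $x\mapsto(x,x)$. Here $t^{Lie}(\eta^{ij}(x))$ lies in the summand $\mathfrak g$ and $\eta^{ij}(y)-\eta^{ij}(x)$ in the summand $\mathfrak h$. -/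

import Mathlib

open scoped Manifold ContDiff
open Set

/-! ### Categories presented by objects and arrows -/

/-- A category given by its objects `O`, its arrows `A`, and the source, target, identity and
composition maps. `comp g f` is the composite `g ∘ f`; it is only meaningful when
`src g = tgt f` and unconstrained otherwise. -/
structure ArrowCategory (O A : Type*) where
  src : A → O
  tgt : A → O
  idn : O → A
  comp : A → A → A
  src_idn : ∀ x, src (idn x) = x
  tgt_idn : ∀ x, tgt (idn x) = x
  src_comp : ∀ g f, src g = tgt f → src (comp g f) = src f
  tgt_comp : ∀ g f, src g = tgt f → tgt (comp g f) = tgt g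
  idn_comp : ∀ f, comp (idn (tgt f)) f = f
  comp_idn : ∀ f, comp f (idn (src f)) = f
  assoc : ∀ k g f, src k = tgt g → src g = tgt f → comp k (comp g f) = comp (comp k g) f

namespace ArrowCategory

variable {O A O' A' : Type*}

/-- A (not necessarily full) subcategory. -/
structure Sub (C : ArrowCategory O A) where
  obj : Set O
  arr : Set A
  src_mem : ∀ a ∈ arr, C.src a ∈ obj
  tgt_mem : ∀ a ∈ arr, C.tgt a ∈ obj
  idn_mem : ∀ x ∈ obj, C.idn x ∈ arr
  comp_mem : ∀ a ∈ arr, ∀ b ∈ arr, C.src b = C.tgt a → C.comp b a ∈ arr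

/-- The whole category as a subcategory of itself. -/
def whole (C : ArrowCategory O A) : C.Sub where
  obj := univ
  arr := univ
  src_mem _ _ := mem_univ _
  tgt_mem _ _ := mem_univ _
  idn_mem _ _ := mem_univ _
  comp_mem _ _ _ _ _ := mem_univ _

/-- `(FO, FA)` is a functor from the subcategory `S` of `C` to the subcategory `T` of `D`.
The values of the maps outside `S` are irrelevant. -/
structure IsFunctorOn {C : ArrowCategory O A} {D : ArrowCategory O' A'} (S : C.Sub) (T : D.Sub)
    (FO : O → O') (FA : A → A') : Prop where
  obj_mem : ∀ x ∈ S.obj, FO x ∈ T.obj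
  arr_mem : ∀ a ∈ S.arr, FA a ∈ T.arr
  map_src : ∀ a ∈ S.arr, D.src (FA a) = FO (C.src a)
  map_tgt : ∀ a ∈ S.arr, D.tgt (FA a) = FO (C.tgt a)
  map_idn : ∀ x ∈ S.obj, FA (C.idn x) = D.idn (FO x)
  map_comp : ∀ a ∈ S.arr, ∀ b ∈ S.arr, C.src b = C.tgt a →
    FA (C.comp b a) = D.comp (FA b) (FA a)

/-- `κ` is a natural equivalence (natural isomorphism), inside the subcategory `S`, from the
identity functor of `S` to the endofunctor `(FO, FA)` of `S`. -/
structure IsNatEquivFromId {C : ArrowCategory O A} (S : C.Sub)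
    (FO : O → O) (FA : A → A) (κ : O → A) : Prop where
  mem : ∀ x ∈ S.obj, κ x ∈ S.arr
  src_eq : ∀ x ∈ S.obj, C.src (κ x) = x
  tgt_eq : ∀ x ∈ S.obj, C.tgt (κ x) = FO x
  natural : ∀ a ∈ S.arr, C.comp (κ (C.tgt a)) a = C.comp (FA a) (κ (C.src a))
  invertible : ∀ x ∈ S.obj, ∃ b ∈ S.arr, C.src b = FO x ∧ C.tgt b = x ∧
    C.comp b (κ x) = C.idn x ∧ C.comp (κ x) b = C.idn (FO x)

/-- The product of two categories. -/
def prod (C : ArrowCategory O A) (D : ArrowCategory O' A') :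
    ArrowCategory (O × O') (A × A') where
  src a := (C.src a.1, D.src a.2)
  tgt a := (C.tgt a.1, D.tgt a.2)
  idn x := (C.idn x.1, D.idn x.2)
  comp b a := (C.comp b.1 a.1, D.comp b.2 a.2)
  src_idn x := by simp [src_idn]
  tgt_idn x := by simp [tgt_idn]
  src_comp g f h := by
    simp only [Prod.mk.injEq] at h
    simp [src_comp _ _ _ h.1, src_comp _ _ _ h.2]
  tgt_comp g f h := by
    simp only [Prod.mk.injEq] at h
    simp [tgt_comp _ _ _ h.1, tgt_comp _ _ _ h.2]
  idn_comp f := by simp [idn_comp]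
  comp_idn f := by simp [comp_idn]
  assoc k g f h h' := by
    simp only [Prod.mk.injEq] at h h'
    simp [assoc _ _ _ _ h.1 h'.1, assoc _ _ _ _ h.2 h'.2]

/-- The product of a subcategory of `C` with the whole of `D`. -/
def Sub.prodWhole {C : ArrowCategory O A} (S : C.Sub) (D : ArrowCategory O' A') :
    (C.prod D).Sub where
  obj := {x | x.1 ∈ S.obj}
  arr := {a | a.1 ∈ S.arr}
  src_mem _ ha := S.src_mem _ ha
  tgt_mem _ ha := S.tgt_mem _ ha
  idn_mem _ hx := S.idn_mem _ hx
  comp_mem _ ha _ hb h := S.comp_mem _ ha _ hb (congrArg Prod.fst h)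

/-- The preimage of a subcategory under a functor. -/
def Sub.preimage {C : ArrowCategory O A} {D : ArrowCategory O' A'} (T : D.Sub)
    {FO : O → O'} {FA : A → A'} (hF : IsFunctorOn C.whole D.whole FO FA) : C.Sub where
  obj := {x | FO x ∈ T.obj}
  arr := {a | FA a ∈ T.arr}
  src_mem a ha := by
    have := T.src_mem _ ha
    rwa [hF.map_src a (mem_univ _)] at this
  tgt_mem a ha := by
    have := T.tgt_mem _ ha
    rwa [hF.map_tgt a (mem_univ _)] at this
  idn_mem x hx := by
    have := T.idn_mem _ hx
    rwa [← hF.map_idn x (mem_univ _)] at this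
  comp_mem a ha b hb h := by
    have h' : D.src (FA b) = D.tgt (FA a) := by
      rw [hF.map_src b (mem_univ _), hF.map_tgt a (mem_univ _), h]
    have := T.comp_mem _ ha _ hb h'
    rwa [← hF.map_comp a (mem_univ _) b (mem_univ _) h] at this

end ArrowCategory

/-! ### Affine 2-spaces -/

/-- The set `M²/R` of the linkable pairs `(y, x)`, written target first. Its topology and its
manifold structure are supplied separately (it need not carry the subspace topology). -/
def LinkedPair {M : Type*} (R : M → M → Prop) : Type _ := {p : M × M // R p.1 p.2}

namespace LinkedPair

variable {M : Type*} {R : M → M → Prop}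

/-- The target `y` of the pair `(y, x)`. -/
def y (n : LinkedPair R) : M := n.1.1

/-- The source `x` of the pair `(y, x)`. -/
def x (n : LinkedPair R) : M := n.1.2

/-- The pair `(y, x)`. -/
def of (y x : M) (h : R y x) : LinkedPair R := ⟨(y, x), h⟩

end LinkedPair

/-- The finite nonempty sequences `(x_n, ..., x_1)` with consecutive entries linkable. -/
def IsLinked {M : Type*} (R : M → M → Prop) (l : List M) : Prop := l ≠ [] ∧ l.IsChain R

/-- An affine 2-space: a smooth 2-space with manifold of objects `M` and manifold of arrows `A`, a
reflexive and symmetric relation `R` on `M`, and a map `φ` from the linked sequences to the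
arrows (`φ` is a function on all lists, only its values on linked sequences matter). The set
`M²/R` of the linkable pairs is a manifold immersed in `M × M`, on which `(y, x) ↦ φ (y, x)` and to
which the diagonal map are smooth. -/
structure AffineTwoSpace (EM EN EA : Type*)
    [NormedAddCommGroup EM] [NormedSpace ℝ EM] [NormedAddCommGroup EN] [NormedSpace ℝ EN]
    [NormedAddCommGroup EA] [NormedSpace ℝ EA]
    {M : Type*} [TopologicalSpace M] [ChartedSpace EM M] [IsManifold 𝓘(ℝ, EM) ∞ M]
    (R : M → M → Prop) [TopologicalSpace (LinkedPair R)] [ChartedSpace EN (LinkedPair R)]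
    [IsManifold 𝓘(ℝ, EN) ∞ (LinkedPair R)]
    (A : Type*) [TopologicalSpace A] [ChartedSpace EA A] [IsManifold 𝓘(ℝ, EA) ∞ A]
    extends ArrowCategory M A where
  smooth_src : ContMDiff 𝓘(ℝ, EA) 𝓘(ℝ, EM) ∞ src
  smooth_tgt : ContMDiff 𝓘(ℝ, EA) 𝓘(ℝ, EM) ∞ tgt
  smooth_idn : ContMDiff 𝓘(ℝ, EM) 𝓘(ℝ, EA) ∞ idn
  /-- Smoothness of the composition on the fibre product of `src` and `tgt`, tested on smooth
  families of composable arrows. -/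
  smooth_comp : ∀ (k : ℕ) (b a : EuclideanSpace ℝ (Fin k) → A),
    ContMDiff 𝓘(ℝ, EuclideanSpace ℝ (Fin k)) 𝓘(ℝ, EA) ∞ b →
    ContMDiff 𝓘(ℝ, EuclideanSpace ℝ (Fin k)) 𝓘(ℝ, EA) ∞ a →
    (∀ u, src (b u) = tgt (a u)) →
    ContMDiff 𝓘(ℝ, EuclideanSpace ℝ (Fin k)) 𝓘(ℝ, EA) ∞ (fun u => comp (b u) (a u))
  refl : ∀ x, R x x
  symm : ∀ x y, R x y → R y x
  φ : List M → A
  src_φ : ∀ l x, IsLinked R (l ++ [x]) → src (φ (l ++ [x])) = x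
  tgt_φ : ∀ y l, IsLinked R (y :: l) → tgt (φ (y :: l)) = y
  φ_singleton : ∀ x, φ [x] = idn x
  φ_repeat : ∀ l x r, IsLinked R (l ++ x :: x :: r) → φ (l ++ x :: x :: r) = φ (l ++ x :: r)
  φ_comp : ∀ l y r, IsLinked R (l ++ [y]) → IsLinked R (y :: r) →
    comp (φ (l ++ [y])) (φ (y :: r)) = φ (l ++ y :: r)
  φ_surj : ∀ f, ∃ l, IsLinked R l ∧ φ l = f
  /-- Among the linked sequences representing an arrow, the one of minimal length is unique. -/
  φ_minimal : ∀ l l', IsLinked R l → IsLinked R l' → φ l = φ l' →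
    (∀ m, IsLinked R m → φ m = φ l → l.length ≤ m.length) → l'.length = l.length → l = l'
  smooth_pair : ContMDiff 𝓘(ℝ, EN) 𝓘(ℝ, EA) ∞ (fun n : LinkedPair R => φ [n.y, n.x])
  smooth_diag : ContMDiff 𝓘(ℝ, EM) 𝓘(ℝ, EN) ∞ (fun x : M => LinkedPair.of x x (refl x))
  immersion : ∀ n : LinkedPair R, Function.Injective
    (mfderiv 𝓘(ℝ, EN) (𝓘(ℝ, EM).prod 𝓘(ℝ, EM)) (fun n : LinkedPair R => (n.y, n.x)) n)

namespace AffineTwoSpace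

variable {EM EN EA : Type*}
  [NormedAddCommGroup EM] [NormedSpace ℝ EM] [NormedAddCommGroup EN] [NormedSpace ℝ EN]
  [NormedAddCommGroup EA] [NormedSpace ℝ EA]
  {M : Type*} [TopologicalSpace M] [ChartedSpace EM M] [IsManifold 𝓘(ℝ, EM) ∞ M]
  {R : M → M → Prop} [TopologicalSpace (LinkedPair R)] [ChartedSpace EN (LinkedPair R)]
  [IsManifold 𝓘(ℝ, EN) ∞ (LinkedPair R)]
  {A : Type*} [TopologicalSpace A] [ChartedSpace EA A] [IsManifold 𝓘(ℝ, EA) ∞ A]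

/-- The diagonal map `x ↦ (x, x)` from `M` to the linkable pairs. -/
def diag (𝓜 : AffineTwoSpace EM EN EA R A) (x : M) : LinkedPair R := LinkedPair.of x x (𝓜.refl x)

/-- The open affine sub-2-space with set of objects `U`: its arrows are the images of the linked
sequences of points of `U`. -/
def sub (𝓜 : AffineTwoSpace EM EN EA R A) (U : Set M) : 𝓜.toArrowCategory.Sub where
  obj := U
  arr := {f | ∃ l, IsLinked R l ∧ (∀ z ∈ l, z ∈ U) ∧ 𝓜.φ l = f}
  src_mem := by
    rintro _ ⟨l, hl, hU, rfl⟩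
    obtain ⟨r, x, rfl⟩ := (List.eq_nil_or_concat' l).resolve_left hl.1
    rw [𝓜.src_φ r x hl]
    exact hU x (by simp)
  tgt_mem := by
    rintro _ ⟨l, hl, hU, rfl⟩
    obtain ⟨y, r, rfl⟩ := List.exists_cons_of_ne_nil hl.1
    rw [𝓜.tgt_φ y r hl]
    exact hU y (by simp)
  idn_mem x hx := ⟨[x], ⟨by simp, by simp⟩, by simpa using hx, 𝓜.φ_singleton x⟩
  comp_mem := by
    rintro _ ⟨l, hl, hU, rfl⟩ _ ⟨l', hl', hU', rfl⟩ h
    obtain ⟨y, r, rfl⟩ := List.exists_cons_of_ne_nil hl.1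
    obtain ⟨r', x, rfl⟩ := (List.eq_nil_or_concat' l').resolve_left hl'.1
    rw [𝓜.tgt_φ y r hl, 𝓜.src_φ r' x hl'] at h
    subst h
    refine ⟨r' ++ x :: r, ⟨by simp, ?_⟩, ?_, (𝓜.φ_comp r' x r hl' hl).symm⟩
    · have := List.isChain_split.2 ⟨hl'.2, hl.2⟩
      simpa using this
    · intro z hz
      simp only [List.mem_append, List.mem_cons] at hz
      rcases hz with hz | hz | hz
      · exact hU' z (by simp [hz])
      · exact hU z (by simp [hz])
      · exact hU z (by simp [hz])

end AffineTwoSpace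

/-- A good open cover: contractible open sets that cover `M`. -/
structure IsGoodCover {M : Type*} [TopologicalSpace M] {ι : Type*} (U : ι → Set M) : Prop where
  isOpen : ∀ i, IsOpen (U i)
  contractible : ∀ i, ContractibleSpace (U i)
  cover : ⋃ i, U i = univ

/-! ### Lie crossed modules -/

/-- A Lie crossed module `(G, H, t, α)`. -/
structure LieCrossedModule (EG EH : Type*)
    [NormedAddCommGroup EG] [NormedSpace ℝ EG] [NormedAddCommGroup EH] [NormedSpace ℝ EH]
    (G : Type*) [TopologicalSpace G] [ChartedSpace EG G] [Group G] [LieGroup 𝓘(ℝ, EG) ∞ G]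
    (H : Type*) [TopologicalSpace H] [ChartedSpace EH H] [Group H] [LieGroup 𝓘(ℝ, EH) ∞ H] where
  t : H →* G
  α : G →* MulAut H
  smooth_t : ContMDiff 𝓘(ℝ, EH) 𝓘(ℝ, EG) ∞ t
  smooth_α : ContMDiff (𝓘(ℝ, EG).prod 𝓘(ℝ, EH)) 𝓘(ℝ, EH) ∞ (fun p : G × H => α p.1 p.2)
  equivariant : ∀ g h, t (α g h) = g * t h * g⁻¹
  peiffer : ∀ h h', α (t h) h' = h * h' * h⁻¹

namespace LieCrossedModule

variable {EG EH : Type*}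
  [NormedAddCommGroup EG] [NormedSpace ℝ EG] [NormedAddCommGroup EH] [NormedSpace ℝ EH]
  {G : Type*} [TopologicalSpace G] [ChartedSpace EG G] [Group G] [LieGroup 𝓘(ℝ, EG) ∞ G]
  {H : Type*} [TopologicalSpace H] [ChartedSpace EH H] [Group H] [LieGroup 𝓘(ℝ, EH) ∞ H]

/-- The semidirect product `H ⋊ G`, as a group on the product manifold `H × G`. -/
def ArrowGroup (_X : LieCrossedModule EG EH G H) : Type _ := H × G

variable (X : LieCrossedModule EG EH G H)

/-- The element `(h, g)` of `H ⋊ G`. -/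
def pair (h : H) (g : G) : X.ArrowGroup := (h, g)

/-- The component in `H`. -/
def left (q : X.ArrowGroup) : H := Prod.fst q

/-- The component in `G`. -/
def right (q : X.ArrowGroup) : G := Prod.snd q

instance : TopologicalSpace X.ArrowGroup := inferInstanceAs (TopologicalSpace (H × G))

instance : ChartedSpace (ModelProd EH EG) X.ArrowGroup :=
  inferInstanceAs (ChartedSpace (ModelProd EH EG) (H × G))

/-- The identification with Mathlib's semidirect product. -/
noncomputable def arrowEquiv : X.ArrowGroup ≃ H ⋊[X.α] G := SemidirectProduct.equivProd.symm

noncomputable instance : Group X.ArrowGroup := X.arrowEquiv.group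

@[simp] theorem left_pair (h : H) (g : G) : X.left (X.pair h g) = h := rfl

@[simp] theorem right_pair (h : H) (g : G) : X.right (X.pair h g) = g := rfl

@[simp] theorem pair_left_right (q : X.ArrowGroup) : X.pair (X.left q) (X.right q) = q := rfl

theorem pair_mul_pair (h h' : H) (g g' : G) :
    X.pair h g * X.pair h' g' = X.pair (h * X.α g h') (g * g') := rfl

theorem one_eq : (1 : X.ArrowGroup) = X.pair 1 1 := rfl

/-- The model with corners of `H ⋊ G`. The model vector space `EH × EG` is the space
underlying the semidirect sum of the Lie algebras of `H` and `G`. -/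
noncomputable abbrev arrowModel (_X : LieCrossedModule EG EH G H) :
    ModelWithCorners ℝ (EH × EG) (ModelProd EH EG) := 𝓘(ℝ, EH).prod 𝓘(ℝ, EG)

/-- `H ⋊ G` is a Lie group. -/
instance : LieGroup X.arrowModel ∞ X.ArrowGroup where
  toIsManifold := inferInstanceAs (IsManifold (𝓘(ℝ, EH).prod 𝓘(ℝ, EG)) ∞ (H × G))
  contMDiff_mul := by
    have hα := X.smooth_α
    have h : ContMDiff ((𝓘(ℝ, EH).prod 𝓘(ℝ, EG)).prod (𝓘(ℝ, EH).prod 𝓘(ℝ, EG)))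
        (𝓘(ℝ, EH).prod 𝓘(ℝ, EG)) ∞
        (fun p : (H × G) × (H × G) => (p.1.1 * X.α p.1.2 p.2.1, p.1.2 * p.2.2)) := by
      refine ContMDiff.prodMk ?_ ?_
      · exact (contMDiff_fst.comp contMDiff_fst).mul
          (hα.comp ((contMDiff_snd.comp contMDiff_fst).prodMk (contMDiff_fst.comp contMDiff_snd)))
      · exact (contMDiff_snd.comp contMDiff_fst).mul (contMDiff_snd.comp contMDiff_snd)
    exact h
  contMDiff_inv := by
    have hα := X.smooth_α
    have h : ContMDiff (𝓘(ℝ, EH).prod 𝓘(ℝ, EG)) (𝓘(ℝ, EH).prod 𝓘(ℝ, EG)) ∞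
        (fun p : H × G => (X.α p.2⁻¹ p.1⁻¹, p.2⁻¹)) := by
      refine ContMDiff.prodMk ?_ ?_
      · exact hα.comp (contMDiff_snd.inv.prodMk contMDiff_fst.inv)
      · exact contMDiff_snd.inv
    exact h

/-- The Lie crossed module as a category: its objects are the elements of `G`, its arrows the
elements of `H ⋊ G`, with `s(h, g) = g` and `t(h, g) = t(h) g`. -/
noncomputable def category : ArrowCategory G X.ArrowGroup where
  src q := X.right q
  tgt q := X.t (X.left q) * X.right q
  idn g := X.pair 1 g
  comp q' q := X.pair (X.left q' * X.left q) (X.right q)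
  src_idn g := rfl
  tgt_idn g := by simp
  src_comp q' q h := rfl
  tgt_comp q' q h := by
    have h' : X.right q' = X.t (X.left q) * X.right q := h
    rw [h']
    simp [mul_assoc]
  idn_comp q := by simp
  comp_idn q := by simp
  assoc k q' q _ _ := by simp [mul_assoc]

instance normal_range : X.t.range.Normal where
  conj_mem := by
    rintro _ ⟨h, rfl⟩ g
    exact ⟨X.α g h, X.equivariant g h⟩

end LieCrossedModule

/-! ### Infinitesimal calculus on Lie groups

The tangent space of a manifold modelled on `E` is, at each point, a copy of `E` in Mathlib. The Lie
algebra of a Lie group modelled on `E` is its tangent space at `1` and is written `E` below. -/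

section LieGroups

variable {EB : Type*} [NormedAddCommGroup EB] [NormedSpace ℝ EB]
  {HB : Type*} [TopologicalSpace HB] (IB : ModelWithCorners ℝ EB HB)
  {B : Type*} [TopologicalSpace B] [ChartedSpace HB B] [IsManifold IB ∞ B]
  {EK : Type*} [NormedAddCommGroup EK] [NormedSpace ℝ EK]
  {HK : Type*} [TopologicalSpace HK] (IK : ModelWithCorners ℝ EK HK)
  {K : Type*} [TopologicalSpace K] [ChartedSpace HK K] [Group K] [LieGroup IK ∞ K]

/-- The adjoint representation `Ad k`, the derivative at `1` of `x ↦ k x k⁻¹`. -/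
noncomputable def lieAd (k : K) : EK →L[ℝ] EK :=
  mfderiv IK IK (fun x : K => k * x * k⁻¹) 1

/-- The 1-form `f⁻¹ df` (at the point `b`), with values in the Lie algebra of `K`. -/
noncomputable def invMulD (f : B → K) (b : B) : TangentSpace IB b →L[ℝ] EK :=
  mfderiv IB IK (fun b' : B => (f b)⁻¹ * f b') b

/-- Differential 1-forms on `B` with values in the vector space `V` (possibly discontinuous). -/
abbrev OneForm (B : Type*) [TopologicalSpace B] [ChartedSpace HB B]
    (V : Type*) [NormedAddCommGroup V] [NormedSpace ℝ V] : Type _ :=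
  ∀ b : B, TangentSpace IB b →L[ℝ] V

variable {IB} in
/-- The 1-form `θ` is smooth on the set `S`: it is smooth as a function on the tangent bundle. -/
def OneForm.SmoothOn {V : Type*} [NormedAddCommGroup V] [NormedSpace ℝ V]
    (θ : OneForm IB B V) (S : Set B) : Prop :=
  ContMDiffOn IB.tangent 𝓘(ℝ, V) ∞ (fun v : TangentBundle IB B => θ v.proj v.2)
    {v | v.proj ∈ S}

/-- `θ` is a connection 1-form on the principal `K`-bundle `S × K` over the open set `S` of `B`
(with `K` acting by right multiplication): it is smooth, it restores the generators of the
fundamental vector fields, and `R_k^* θ = Ad(k⁻¹) θ`. The corresponding connection (distribution of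
horizontal spaces) is its kernel. -/
structure IsConnectionForm (S : Set B)
    (θ : OneForm (IB.prod IK) (B × K) EK) : Prop where
  smooth : OneForm.SmoothOn θ (S ×ˢ univ)
  fundamental : ∀ b ∈ S, ∀ (k : K) (Y : TangentSpace IK (1 : K)),
    θ (b, k * 1) (mfderiv IK (IB.prod IK) (fun k' : K => (b, k * k')) 1 Y) = Y
  equivariant : ∀ b ∈ S, ∀ (k l : K) (v : TangentSpace (IB.prod IK) (b, k)),
    θ (b, k * l) (mfderiv (IB.prod IK) (IB.prod IK) (fun p : B × K => (p.1, p.2 * l)) (b, k) v)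
      = lieAd IK l⁻¹ (θ (b, k) v)

/-- The horizontal space at `p` of the connection with connection 1-form `θ`. -/
def horizontal (θ : OneForm (IB.prod IK) (B × K) EK) (p : B × K) :
    Set (TangentSpace (IB.prod IK) p) := {v | θ p v = 0}

/-- A connection on the principal `K`-bundle over `B` obtained by gluing the products `S i × K`
along `(b, k)_j ∼ (b, c i j b * k)_i` for `b ∈ S i ∩ S j`. The total space is covered by the open
submanifolds `S i × K`, so that a 1-form on it is a family of 1-forms on the `S i × K` which
correspond to each other under the changes of trivialization. -/
structure IsGlobalConnection {ι : Type*} (S : ι → Set B)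
    (c : ι → ι → B → K) (θ : ι → OneForm (IB.prod IK) (B × K) EK) : Prop where
  isConnection : ∀ i, IsConnectionForm IB IK (S i) (θ i)
  glue : ∀ i j, ∀ b ∈ S i ∩ S j, ∀ (k : K) (v : TangentSpace (IB.prod IK) (b, k)),
    θ j (b, k) v = θ i (b, c i j b * k)
      (mfderiv (IB.prod IK) (IB.prod IK) (fun p : B × K => (p.1, c i j p.1 * p.2)) (b, k) v)

/-- The gauge potential: the pull-back of `θ` by the trivializing section `b ↦ (b, 1)`. -/
noncomputable def potential (θ : OneForm (IB.prod IK) (B × K) EK) : OneForm IB B EK :=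
  fun b => (θ (b, 1)).comp (mfderiv IB (IB.prod IK) (fun b' : B => (b', (1 : K))) b)

end LieGroups

namespace LieCrossedModule

variable {EG EH : Type*}
  [NormedAddCommGroup EG] [NormedSpace ℝ EG] [NormedAddCommGroup EH] [NormedSpace ℝ EH]
  {G : Type*} [TopologicalSpace G] [ChartedSpace EG G] [Group G] [LieGroup 𝓘(ℝ, EG) ∞ G]
  {H : Type*} [TopologicalSpace H] [ChartedSpace EH H] [Group H] [LieGroup 𝓘(ℝ, EH) ∞ H]
  (X : LieCrossedModule EG EH G H)

/-- `t^Lie`, the derivative of `t` at the identity. -/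
noncomputable def tLie : EH →L[ℝ] EG := mfderiv 𝓘(ℝ, EH) 𝓘(ℝ, EG) X.t 1

/-- The action of `g ∈ G` on the Lie algebra of `H`, the derivative of `α_g` at the identity. -/
noncomputable def αAct (g : G) : EH →L[ℝ] EH :=
  mfderiv 𝓘(ℝ, EH) 𝓘(ℝ, EH) (fun h : H => X.α g h) 1

/-- `h⁻¹ α^Lie_Y(h)`, for `h ∈ H` and `Y` in the Lie algebra of `G`: the derivative at `1`, in the
direction `Y`, of `g ↦ h⁻¹ α_g(h)`. -/
noncomputable def invMulαLie (h : H) : EG →L[ℝ] EH :=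
  mfderiv 𝓘(ℝ, EG) 𝓘(ℝ, EH) (fun g : G => h⁻¹ * X.α g h) 1

/-- The quotient group `G / t(H)` (with its quotient topology and the given charts) is a quotient
Lie group: the projection is a smooth submersion. -/
structure IsQuotientLieGroup {EK : Type*} [NormedAddCommGroup EK] [NormedSpace ℝ EK]
    [ChartedSpace EK (G ⧸ X.t.range)] : Prop where
  smooth : ContMDiff 𝓘(ℝ, EG) 𝓘(ℝ, EK) ∞ (fun g : G => (g : G ⧸ X.t.range))
  submersion : ∀ g : G, Function.Surjective
    (mfderiv 𝓘(ℝ, EG) 𝓘(ℝ, EK) (fun g : G => (g : G ⧸ X.t.range)) g)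

end LieCrossedModule

/-! ### Principal 2-bundles -/

section TwoBundles

variable {EM EN EA : Type*}
  [NormedAddCommGroup EM] [NormedSpace ℝ EM] [NormedAddCommGroup EN] [NormedSpace ℝ EN]
  [NormedAddCommGroup EA] [NormedSpace ℝ EA]
  {M : Type*} [TopologicalSpace M] [ChartedSpace EM M] [IsManifold 𝓘(ℝ, EM) ∞ M]
  {R : M → M → Prop} [TopologicalSpace (LinkedPair R)] [ChartedSpace EN (LinkedPair R)]
  [IsManifold 𝓘(ℝ, EN) ∞ (LinkedPair R)]
  {A : Type*} [TopologicalSpace A] [ChartedSpace EA A] [IsManifold 𝓘(ℝ, EA) ∞ A]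
  {EG EH : Type*}
  [NormedAddCommGroup EG] [NormedSpace ℝ EG] [NormedAddCommGroup EH] [NormedSpace ℝ EH]
  {G : Type*} [TopologicalSpace G] [ChartedSpace EG G] [Group G] [LieGroup 𝓘(ℝ, EG) ∞ G]
  {H : Type*} [TopologicalSpace H] [ChartedSpace EH H] [Group H] [LieGroup 𝓘(ℝ, EH) ∞ H]
  {ι : Type*}

/-- The subcategory `𝒰 × 𝒢` of `𝓜 × 𝒢`, where `𝒰` has set of objects `U`. -/
noncomputable def chart (𝓜 : AffineTwoSpace EM EN EA R A) (X : LieCrossedModule EG EH G H) (U : Set M) :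
    (𝓜.toArrowCategory.prod X.category).Sub :=
  (𝓜.sub U).prodWhole X.category

/-- A principal 2-bundle over the affine 2-space `𝓜` with 2-cover given by `U` and structure
groupoid the Lie crossed module `X`: a category with objects `PO` and arrows `PA`, a functor
`(πO, πA)` to `𝓜`, and for each `i` an equivalence `(φO i, φA i)` from `𝒰^i × 𝒢` to `π⁻¹(𝒰^i)` with
weak inverse `(φO' i, φA' i)` and natural equivalences `κ i`, `κ' i`. -/
structure TwoBundle (𝓜 : AffineTwoSpace EM EN EA R A) (X : LieCrossedModule EG EH G H)
    (U : ι → Set M) (PO PA : Type*) where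
  cat : ArrowCategory PO PA
  πO : PO → M
  πA : PA → A
  functor : ArrowCategory.IsFunctorOn cat.whole 𝓜.toArrowCategory.whole πO πA
  surj_obj : Function.Surjective πO
  surj_arr : Function.Surjective πA
  φO : ι → M × G → PO
  φA : ι → A × X.ArrowGroup → PA
  φO' : ι → PO → M × G
  φA' : ι → PA → A × X.ArrowGroup
  φ_functor : ∀ i, ArrowCategory.IsFunctorOn
    (chart 𝓜 X (U i)) ((𝓜.sub (U i)).preimage functor) (φO i) (φA i)
  φ'_functor : ∀ i, ArrowCategory.IsFunctorOn
    ((𝓜.sub (U i)).preimage functor) (chart 𝓜 X (U i)) (φO' i) (φA' i)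
  κ : ι → M × G → A × X.ArrowGroup
  κ' : ι → PO → PA
  κ_equiv : ∀ i, ArrowCategory.IsNatEquivFromId (chart 𝓜 X (U i))
    (φO' i ∘ φO i) (φA' i ∘ φA i) (κ i)
  κ'_equiv : ∀ i, ArrowCategory.IsNatEquivFromId ((𝓜.sub (U i)).preimage functor)
    (φO i ∘ φO' i) (φA i ∘ φA' i) (κ' i)
  fst_φO' : ∀ i, ∀ p, πO p ∈ U i → (φO' i p).1 = πO p
  fst_φA' : ∀ i, ∀ f, πA f ∈ (𝓜.sub (U i)).arr → (φA' i f).1 = πA f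
  equivariant : ∀ i, ∀ x ∈ U i, ∀ g g' : G,
    ((φO' i (φO i (x, g))).1, (φO' i (φO i (x, g))).2 * g') = φO' i (φO i (x, g * g'))

variable {𝓜 : AffineTwoSpace EM EN EA R A} {X : LieCrossedModule EG EH G H}
  {U : ι → Set M} {PO PA : Type*}

/-- The set of the linkable pairs of points of `S`. -/
def pairsIn (R : M → M → Prop) (S : Set M) : Set (LinkedPair R) := {n | n.y ∈ S ∧ n.x ∈ S}

/-- `g` and `h` are the (smooth) `G`-transition functions `g^{ij}(x)` and `H`-transition functions
`h^{ij}(y, x)` of the 2-bundle `𝓟`. -/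
structure IsTransition (𝓟 : TwoBundle 𝓜 X U PO PA) (g : ι → ι → M → G)
    (h : ι → ι → M → M → H) : Prop where
  smooth_g : ∀ i j, ContMDiffOn 𝓘(ℝ, EM) 𝓘(ℝ, EG) ∞ (g i j) (U i ∩ U j)
  smooth_h : ∀ i j, ContMDiffOn 𝓘(ℝ, EN) 𝓘(ℝ, EH) ∞
    (fun n : LinkedPair R => h i j n.y n.x) (pairsIn R (U i ∩ U j))
  map_obj : ∀ i j, ∀ x ∈ U i ∩ U j, ∀ k : G,
    𝓟.φO' i (𝓟.φO j (x, k)) = (x, g i j x * k)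
  map_arr : ∀ i j, ∀ f ∈ (𝓜.sub (U i ∩ U j)).arr, ∀ q : X.ArrowGroup,
    𝓟.φA' i (𝓟.φA j (f, q)) = (f, X.pair (h i j (𝓜.tgt f) (𝓜.src f)) (g i j (𝓜.src f)) * q)

/-- `h₂` gives the 2-transition functions `h^{ijk}(x)` of the 2-bundle `𝓟` with `G`-transition
functions `g`: the arrow `(id_x, h^{ijk}(x)⁻¹, g^{ik}(x))` is the image, in the trivialization `i`,
of the natural equivalence from the identity to `φ^j φ'^j` at the point `φ^k(x, 1)`; in other
words `(id_x, h^{ijk}(x), g^{ij}(x) g^{jk}(x))` is the inverse arrow, the component at `(x, 1)` of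
the induced natural equivalence from `φ'^i φ^j φ'^j φ^k` to `φ'^i φ^k`. -/
def IsTwoTransition (𝓟 : TwoBundle 𝓜 X U PO PA) (g : ι → ι → M → G)
    (h₂ : ι → ι → ι → M → H) : Prop :=
  ∀ i j k, ∀ x ∈ U i ∩ U j ∩ U k,
    𝓟.φA' i (𝓟.κ' j (𝓟.φO k (x, 1))) = (𝓜.idn x, X.pair (h₂ i j k x)⁻¹ (g i k x))

/-- The 2-bundle is trivial: its 2-transition functions are trivial. -/
def IsTrivialTwoBundle (𝓟 : TwoBundle 𝓜 X U PO PA) (g : ι → ι → M → G) : Prop :=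
  IsTwoTransition 𝓟 g (fun _ _ _ _ => 1)

/-- The transition functions `q^{ij}(y, x) = (h^{ij}(y, x), g^{ij}(x))` with values in `H ⋊ G`. -/
noncomputable def qTransition (R : M → M → Prop) (X : LieCrossedModule EG EH G H) (g : ι → ι → M → G)
    (h : ι → ι → M → M → H) (i j : ι) (n : LinkedPair R) : X.ArrowGroup :=
  X.pair (h i j n.y n.x) (g i j n.x)

/-! ### 2-connections -/

/-- The three compatibility conditions between a connection `θP` on the bundle of objects
`P^i = {φ^i(x, g)} ≃ S × G` and a connection `θQ` on the bundle of elementary arrows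
`Q^i = {φ^i(yx, h, g)} ≃ S²/R × (H ⋊ G)`, for the identity, source and target maps of arrows. -/
structure IsCompatiblePair (𝓜 : AffineTwoSpace EM EN EA R A) (X : LieCrossedModule EG EH G H)
    (S : Set M)
    (θP : OneForm (𝓘(ℝ, EM).prod 𝓘(ℝ, EG)) (M × G) EG)
    (θQ : OneForm (𝓘(ℝ, EN).prod X.arrowModel) (LinkedPair R × X.ArrowGroup) (EH × EG)) :
    Prop where
  /-- The identity-assigning map `φ^i(x, g) ↦ φ^i(xx, 1, g)` sends horizontal vectors to horizontal
  vectors. -/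
  identity : ∀ p : M × G, p.1 ∈ S →
    mfderiv (𝓘(ℝ, EM).prod 𝓘(ℝ, EG)) (𝓘(ℝ, EN).prod X.arrowModel)
        (fun p : M × G => (𝓜.diag p.1, X.pair 1 p.2)) p '' horizontal _ _ θP p
      ⊆ horizontal _ _ θQ (𝓜.diag p.1, X.pair 1 p.2)
  /-- The target map `φ^i(yx, h, g) ↦ φ^i(y, t(h) g)` maps horizontal spaces onto horizontal
  spaces. -/
  target : ∀ q : LinkedPair R × X.ArrowGroup, q.1 ∈ pairsIn R S →
    mfderiv (𝓘(ℝ, EN).prod X.arrowModel) (𝓘(ℝ, EM).prod 𝓘(ℝ, EG))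
        (fun q : LinkedPair R × X.ArrowGroup => (q.1.y, X.t (X.left q.2) * X.right q.2)) q ''
        horizontal _ _ θQ q
      = horizontal _ _ θP (q.1.y, X.t (X.left q.2) * X.right q.2)
  /-- The source map `φ^i(yx, h, g) ↦ φ^i(x, g)` maps horizontal spaces onto horizontal spaces. -/
  source : ∀ q : LinkedPair R × X.ArrowGroup, q.1 ∈ pairsIn R S →
    mfderiv (𝓘(ℝ, EN).prod X.arrowModel) (𝓘(ℝ, EM).prod 𝓘(ℝ, EG))
        (fun q : LinkedPair R × X.ArrowGroup => (q.1.x, X.right q.2)) q '' horizontal _ _ θQ q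
      = horizontal _ _ θP (q.1.x, X.right q.2)

/-- A 2-connection on a trivial 2-bundle with transition functions `g`, `h`: a connection on the
object-bundle `P` (the principal `G`-bundle over `M` with transition functions `g^{ij}`) and a
connection on the arrow-bundle `Q` (the principal `H ⋊ G`-bundle over the union of the `(U i)²/R`
with transition functions `q^{ij}`), compatible with the identity, source and target maps. -/
structure IsTrivialTwoConnection (𝓜 : AffineTwoSpace EM EN EA R A) (U : ι → Set M)
    (g : ι → ι → M → G) (h : ι → ι → M → M → H)
    (θP : ι → OneForm (𝓘(ℝ, EM).prod 𝓘(ℝ, EG)) (M × G) EG)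
    (θQ : ι → OneForm (𝓘(ℝ, EN).prod X.arrowModel) (LinkedPair R × X.ArrowGroup) (EH × EG)) :
    Prop where
  connP : IsGlobalConnection 𝓘(ℝ, EM) 𝓘(ℝ, EG) U g θP
  connQ : IsGlobalConnection 𝓘(ℝ, EN) X.arrowModel (fun i => pairsIn R (U i))
    (qTransition R X g h) θQ
  compatible : ∀ i, IsCompatiblePair 𝓜 X (U i) (θP i) (θQ i)

/-- A 2-connection on a 2-bundle: connections on the local bundles `P^i` and `Q^i`, and a connection
on the principal `G / t(H)`-bundle over `M` whose transition functions are the classes of the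
`g^{ij}`, compatible with the identity, source and target maps and with the projections
`P^i → P^i / t(H)`. -/
structure IsTwoConnection {EK : Type*} [NormedAddCommGroup EK] [NormedSpace ℝ EK]
    [ChartedSpace EK (G ⧸ X.t.range)] [LieGroup 𝓘(ℝ, EK) ∞ (G ⧸ X.t.range)]
    (𝓜 : AffineTwoSpace EM EN EA R A) (U : ι → Set M) (g : ι → ι → M → G)
    (θP : ι → OneForm (𝓘(ℝ, EM).prod 𝓘(ℝ, EG)) (M × G) EG)
    (θQ : ι → OneForm (𝓘(ℝ, EN).prod X.arrowModel) (LinkedPair R × X.ArrowGroup) (EH × EG))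
    (θR : ι → OneForm (𝓘(ℝ, EM).prod 𝓘(ℝ, EK)) (M × (G ⧸ X.t.range)) EK) : Prop where
  connP : ∀ i, IsConnectionForm 𝓘(ℝ, EM) 𝓘(ℝ, EG) (U i) (θP i)
  connQ : ∀ i, IsConnectionForm 𝓘(ℝ, EN) X.arrowModel (pairsIn R (U i)) (θQ i)
  connR : IsGlobalConnection 𝓘(ℝ, EM) 𝓘(ℝ, EK) U
    (fun i j x => (g i j x : G ⧸ X.t.range)) θR
  compatible : ∀ i, IsCompatiblePair 𝓜 X (U i) (θP i) (θQ i)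
  projection : ∀ i, ∀ p : M × G, p.1 ∈ U i →
    mfderiv (𝓘(ℝ, EM).prod 𝓘(ℝ, EG)) (𝓘(ℝ, EM).prod 𝓘(ℝ, EK))
        (fun p : M × G => (p.1, (p.2 : G ⧸ X.t.range))) p '' horizontal _ _ (θP i) p
      = horizontal _ _ (θR i) (p.1, (p.2 : G ⧸ X.t.range))

/-- `η₂` is a potential-transformation `η^{ij}` of the 2-connection, where `AI` and `AJ` are the
`G`-gauge potentials `A^i` and `A^j` and `gij` is the transition function: a smooth 1-form on
`S = U^i ∩ U^j` with values in the Lie algebra of `H` such that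
`A^j = g⁻¹ A^i g + g⁻¹ dg + t^Lie(η^{ij})`. -/
structure IsPotentialTransformation (X : LieCrossedModule EG EH G H)
    (S : Set M) (gij : M → G) (AI AJ : OneForm 𝓘(ℝ, EM) M EG) (η₂ : OneForm 𝓘(ℝ, EM) M EH) :
    Prop where
  smooth : OneForm.SmoothOn η₂ S
  eq : ∀ x ∈ S, ∀ v : TangentSpace 𝓘(ℝ, EM) x,
    AJ x v = lieAd 𝓘(ℝ, EG) (gij x)⁻¹ (AI x v) + invMulD 𝓘(ℝ, EM) 𝓘(ℝ, EG) gij x v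
      + X.tLie (η₂ x v)

/-- The pull-back to `M²/R` of a 1-form on `M` by the target map `(y, x) ↦ y`. -/
noncomputable def OneForm.atTarget {V : Type*} [NormedAddCommGroup V] [NormedSpace ℝ V]
    (θ : OneForm 𝓘(ℝ, EM) M V) : OneForm 𝓘(ℝ, EN) (LinkedPair R) V :=
  fun n => (θ n.y).comp (mfderiv 𝓘(ℝ, EN) 𝓘(ℝ, EM) (fun n : LinkedPair R => n.y) n)

/-- The pull-back to `M²/R` of a 1-form on `M` by the source map `(y, x) ↦ x`. -/
noncomputable def OneForm.atSource {V : Type*} [NormedAddCommGroup V] [NormedSpace ℝ V]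
    (θ : OneForm 𝓘(ℝ, EM) M V) : OneForm 𝓘(ℝ, EN) (LinkedPair R) V :=
  fun n => (θ n.x).comp (mfderiv 𝓘(ℝ, EN) 𝓘(ℝ, EM) (fun n : LinkedPair R => n.x) n)

/-- The component with values in the Lie algebra of `H` of a 1-form with values in the semidirect
sum. -/
noncomputable def OneForm.partH (θ : OneForm 𝓘(ℝ, EN) (LinkedPair R) (EH × EG)) :
    OneForm 𝓘(ℝ, EN) (LinkedPair R) EH :=
  fun n => (ContinuousLinearMap.fst ℝ EH EG).comp (θ n)

end TwoBundles

/-!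
Why the transformation laws hold.

A connection 1-form on a product bundle `S × K` is determined by its potential: along the graph of a
map `f : B → K` it equals `Ad(f⁻¹) A + f⁻¹ df` (`IsConnectionForm.apply_graph`). For a connection
on a glued bundle this is the change of gauge `A^j = Ad(c⁻¹) A^i + c⁻¹ dc` with the transition
function `c = c^{ij}` (`IsGlobalConnection.potential_eq`).

The vector `(v, -A v)` at the point `(b, 1)` is horizontal, and the structure maps of the 2-bundle
are compatible with horizontal vectors. Evaluating this for the source, target and identity maps
gives three facts on the potential `Z` on linkable pairs: its `𝔤`-component is `A(x)`, the
homomorphism `(h, g) ↦ t(h) g` takes it to `A(y)`, and its pull-back to the diagonal is `(0, A)`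
(`IsCompatiblePair.potential_snd`, `targetHom_potential`, `potential_diag`).

For a trivial 2-bundle the law for `η` is the `𝔥`-component of the change of gauge with transition
function `q^{ij} = (h^{ij}, g^{ij})`, after `α_{g^{ij}}` has been applied to it; the adjoint action
of the inverse of `(h, g)` in `H ⋊ G` is computed in `LieCrossedModule.αAct_lieAd_inv`.

In the general case the potentials on pairs are not related by gluing, and `ζ` is defined as the
`𝔥`-component of the difference of the two sides. The `𝔤`-components agree by the
potential-transformation law at `x`. Since `t(h^{ij}(y, x)) g^{ij}(x) = g^{ij}(y)`
(`IsTransition.targetHom_q`), applying the homomorphism `(h, g) ↦ t(h) g` to both sides gives the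
potential-transformation law at `y`, so `t^Lie ζ = 0`. On the diagonal the
potentials on pairs restrict to `(0, A)`, `h^{ij}(x, x) = 1` (`IsTransition.h_self`) and
`η^{ij}(y) = η^{ij}(x)`, so that every term of `ζ` vanishes there.
-/

/-! ### Derivatives read in the model spaces -/

section ModelDeriv

variable {E E' E'' : Type*}
  [NormedAddCommGroup E] [NormedSpace ℝ E] [NormedAddCommGroup E'] [NormedSpace ℝ E']
  [NormedAddCommGroup E''] [NormedSpace ℝ E'']
  {C C' C'' : Type*} [TopologicalSpace C] [TopologicalSpace C'] [TopologicalSpace C'']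
  (I : ModelWithCorners ℝ E C) (I' : ModelWithCorners ℝ E' C') (I'' : ModelWithCorners ℝ E'' C'')
  {N N' N'' : Type*} [TopologicalSpace N] [ChartedSpace C N] [TopologicalSpace N']
  [ChartedSpace C' N'] [TopologicalSpace N''] [ChartedSpace C'' N'']

/-- The derivative of `f` at `x`, as a map between the model vector spaces. Since its type does not
depend on `x` and `f x`, points may be replaced by propositionally equal ones, such as `k⁻¹ * k`
and `1` in a group. -/
noncomputable def modelDeriv (f : N → N') (x : N) : E →L[ℝ] E' := mfderiv I I' f x

variable {I I' I''}

theorem modelDeriv_comp {g : N' → N''} {f : N → N'} {x : N} (y : N')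
    (hg : MDifferentiableAt I' I'' g y) (hf : MDifferentiableAt I I' f x) (hy : f x = y) (v : E) :
    modelDeriv I I'' (fun x => g (f x)) x v = modelDeriv I' I'' g y (modelDeriv I I' f x v) :=
  mfderiv_comp_apply_of_eq x hg hf hy v

theorem modelDeriv_prodMk {f : N → N'} {g : N → N''} {x : N} (hf : MDifferentiableAt I I' f x)
    (hg : MDifferentiableAt I I'' g x) (v : E) :
    modelDeriv I (I'.prod I'') (fun x => (f x, g x)) x v
      = (modelDeriv I I' f x v, modelDeriv I I'' g x v) :=
  congrArg (fun T : E →L[ℝ] E' × E'' => T v) (mfderiv_prodMk hf hg)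

theorem modelDeriv_id (x : N) (v : E) : modelDeriv I I (fun x => x) x v = v :=
  congrArg (fun T : E →L[ℝ] E => T v) (mfderiv_id (I := I) (x := x))

theorem modelDeriv_const (c : N') (x : N) (v : E) : modelDeriv I I' (fun _ => c) x v = 0 :=
  congrArg (fun T : E →L[ℝ] E' => T v) (mfderiv_const (I := I) (I' := I') (x := x) (c := c))

theorem modelDeriv_fst (p : N × N') (v : E × E') :
    modelDeriv (I.prod I') I Prod.fst p v = v.1 :=
  congrArg (fun T : E × E' →L[ℝ] E => T v) (mfderiv_fst (I := I) (I' := I') (x := p))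

theorem modelDeriv_snd (p : N × N') (v : E × E') :
    modelDeriv (I.prod I') I' Prod.snd p v = v.2 :=
  congrArg (fun T : E × E' →L[ℝ] E' => T v) (mfderiv_snd (I := I) (I' := I') (x := p))

/-- Change of base point along an equality, with the tangent vector read in the model space. -/
theorem OneForm.apply_congr {V : Type*} [NormedAddCommGroup V] [NormedSpace ℝ V]
    (θ : OneForm I N V) {p p' : N} (h : p = p') (v : E) :
    θ p (v : TangentSpace I p) = θ p' (v : TangentSpace I p') := by
  subst h; rfl

end ModelDeriv

/-! ### Infinitesimal calculus on Lie groups -/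

section LieGroups

variable {EB : Type*} [NormedAddCommGroup EB] [NormedSpace ℝ EB]
  {HB : Type*} [TopologicalSpace HB] {IB : ModelWithCorners ℝ EB HB}
  {B : Type*} [TopologicalSpace B] [ChartedSpace HB B]
  {EB' : Type*} [NormedAddCommGroup EB'] [NormedSpace ℝ EB']
  {HB' : Type*} [TopologicalSpace HB'] {IB' : ModelWithCorners ℝ EB' HB'}
  {B' : Type*} [TopologicalSpace B'] [ChartedSpace HB' B']
  {EK : Type*} [NormedAddCommGroup EK] [NormedSpace ℝ EK]
  {HK : Type*} [TopologicalSpace HK] {IK : ModelWithCorners ℝ EK HK}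
  {K : Type*} [TopologicalSpace K] [ChartedSpace HK K] [Group K]
  {EL : Type*} [NormedAddCommGroup EL] [NormedSpace ℝ EL]
  {HL : Type*} [TopologicalSpace HL] {IL : ModelWithCorners ℝ EL HL}
  {L : Type*} [TopologicalSpace L] [ChartedSpace HL L] [Group L]

theorem invMulD_apply (f : B → K) (b : B) (v : EB) :
    invMulD IB IK f b v = modelDeriv IB IK (fun b' => (f b)⁻¹ * f b') b v := rfl

theorem lieAd_apply (k : K) (Z : EK) :
    lieAd IK k Z = modelDeriv IK IK (fun x : K => k * x * k⁻¹) 1 Z := rfl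

theorem invMulD_congr {f f' : B → K} {b : B} (h : f =ᶠ[nhds b] f') :
    invMulD IB IK f b = invMulD IB IK f' b := by
  unfold invMulD
  refine Filter.EventuallyEq.mfderiv_eq ?_
  filter_upwards [h] with b' hb'
  rw [hb', h.eq_of_nhds]

theorem potential_apply (θ : OneForm (IB.prod IK) (B × K) EK) (b : B) (v : EB) :
    potential IB IK θ b v = θ (b, 1) ((v, 0) : EB × EK) := by
  have h : modelDeriv IB (IB.prod IK) (fun b' : B => (b', (1 : K))) b v = (v, 0) := by
    rw [modelDeriv_prodMk (f := fun x : B => x) mdifferentiableAt_id mdifferentiableAt_const,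
      modelDeriv_id, modelDeriv_const]
  exact congrArg (fun w : EB × EK => θ (b, 1) w) h

variable [LieGroup IK ∞ K]

theorem MDifferentiableAt.lieGroup_mul {f f' : B → K} {b : B} (hf : MDifferentiableAt IB IK f b)
    (hf' : MDifferentiableAt IB IK f' b) : MDifferentiableAt IB IK (fun b => f b * f' b) b :=
  ((contMDiff_mul IK ∞ (G := K)).contMDiffAt.mdifferentiableAt (by simp)).comp b
    (hf.prodMk hf')

theorem MDifferentiableAt.lieGroup_const_mul {f : B → K} {b : B}
    (hf : MDifferentiableAt IB IK f b) (k : K) :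
    MDifferentiableAt IB IK (fun b' => k * f b') b :=
  mdifferentiableAt_const.lieGroup_mul hf

theorem mdifferentiableAt_leftTranslation (k l : K) :
    MDifferentiableAt IK IK (fun x => k * x) l :=
  mdifferentiableAt_id.lieGroup_const_mul k

theorem mdifferentiableAt_conj (k l : K) :
    MDifferentiableAt IK IK (fun x => k * x * k⁻¹) l :=
  (mdifferentiableAt_leftTranslation k l).lieGroup_mul mdifferentiableAt_const

/-- At a point where both factors are `1` the derivative of a product is the sum of the
derivatives. -/
theorem modelDeriv_mul_of_eq_one {f f' : B → K} {b : B} (hf : MDifferentiableAt IB IK f b)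
    (hf' : MDifferentiableAt IB IK f' b) (h : f b = 1) (h' : f' b = 1) (v : EB) :
    modelDeriv IB IK (fun b => f b * f' b) b v
      = modelDeriv IB IK f b v + modelDeriv IB IK f' b v := by
  have hm : MDifferentiableAt (IK.prod IK) IK (fun p : K × K => p.1 * p.2) (1, 1) :=
    (contMDiff_mul IK ∞ (G := K)).contMDiffAt.mdifferentiableAt (by simp)
  have h1 := modelDeriv_comp (I := IB) (1, 1) hm (hf.prodMk hf') (by simp [h, h']) v
  have h2 : modelDeriv (IK.prod IK) IK (fun p : K × K => p.1 * p.2) (1, 1)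
      (modelDeriv IB IK f b v, modelDeriv IB IK f' b v)
      = modelDeriv IK IK (fun z : K => z * 1) 1 (modelDeriv IB IK f b v)
        + modelDeriv IK IK (fun z : K => 1 * z) 1 (modelDeriv IB IK f' b v) :=
    mfderiv_prod_eq_add_apply hm
  rw [modelDeriv_prodMk hf hf', h2] at h1
  simpa only [mul_one, one_mul, modelDeriv_id] using h1

/-- Left translation by `f b` takes `f⁻¹ df` back to `df`. -/
theorem modelDeriv_mul_left_invMulD {f : B → K} {b : B}
    (hf : MDifferentiableAt IB IK f b) (v : EB) :
    modelDeriv IK IK (fun k => f b * k) 1 (invMulD IB IK f b v) = modelDeriv IB IK f b v := by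
  rw [invMulD_apply, ← modelDeriv_comp 1 (mdifferentiableAt_leftTranslation _ _)
    (hf.lieGroup_const_mul _) (by simp)]
  simp only [mul_inv_cancel_left]

/-- The 1-form `f⁻¹ df` is compatible with pull-backs. -/
theorem invMulD_comp {f : B → K} {ψ : B' → B} {b' : B'}
    (hf : MDifferentiableAt IB IK f (ψ b')) (hψ : MDifferentiableAt IB' IB ψ b') (v : EB') :
    invMulD IB' IK (fun b' => f (ψ b')) b' v = invMulD IB IK f (ψ b') (modelDeriv IB' IB ψ b' v) := by
  rw [invMulD_apply, invMulD_apply, ← modelDeriv_comp (ψ b') (hf.lieGroup_const_mul _) hψ rfl]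

/-- A homomorphism of Lie groups takes `f⁻¹ df` to the corresponding form of its composite with
`f`. -/
theorem modelDeriv_hom_invMulD (τ : K → L) (hτ : MDifferentiable IK IL τ)
    (hmul : ∀ k k', τ (k * k') = τ k * τ k') {f : B → K} {b : B}
    (hf : MDifferentiableAt IB IK f b) (v : EB) :
    modelDeriv IK IL τ 1 (invMulD IB IK f b v) = invMulD IB IL (fun b => τ (f b)) b v := by
  have hinv : ∀ k, τ k⁻¹ = (τ k)⁻¹ := map_inv (MonoidHom.mk' τ hmul)
  rw [invMulD_apply, invMulD_apply, ← modelDeriv_comp 1 (hτ 1) (hf.lieGroup_const_mul _) (by simp)]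
  simp only [hmul, hinv]

/-- The derivative of a homomorphism of Lie groups intertwines the adjoint representations. -/
theorem modelDeriv_hom_lieAd [LieGroup IL ∞ L] (τ : K → L) (hτ : MDifferentiable IK IL τ)
    (hmul : ∀ k k', τ (k * k') = τ k * τ k') (k : K) (Z : EK) :
    modelDeriv IK IL τ 1 (lieAd IK k Z) = lieAd IL (τ k) (modelDeriv IK IL τ 1 Z) := by
  have hinv : ∀ k, τ k⁻¹ = (τ k)⁻¹ := map_inv (MonoidHom.mk' τ hmul)
  have hone : τ 1 = 1 := map_one (MonoidHom.mk' τ hmul)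
  rw [lieAd_apply, lieAd_apply,
    ← modelDeriv_comp 1 (hτ 1) (mdifferentiableAt_conj _ _) (by simp),
    ← modelDeriv_comp 1 (mdifferentiableAt_conj _ _) (hτ 1) hone]
  simp only [hmul, hinv]

/-! ### Connection forms on trivial principal bundles -/

variable [IsManifold IB ∞ B]

/-- Along the graph of `f`, a connection 1-form is the gauge transform of its potential. -/
theorem IsConnectionForm.apply_graph {S : Set B} {θ : OneForm (IB.prod IK) (B × K) EK}
    (hθ : IsConnectionForm IB IK S θ) {b : B} (hb : b ∈ S) {f : B → K}
    (hf : MDifferentiableAt IB IK f b) (v : EB) :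
    θ (b, f b) ((v, modelDeriv IB IK f b v) : EB × EK)
      = lieAd IK (f b)⁻¹ (potential IB IK θ b v) + invMulD IB IK f b v := by
  -- the vertical part, by reproduction of the generators of fundamental vector fields
  have hfund : θ (b, f b) ((0, modelDeriv IB IK f b v) : EB × EK) = invMulD IB IK f b v := by
    have h := hθ.fundamental b hb (f b) (invMulD IB IK f b v)
    have h' : modelDeriv IK (IB.prod IK) (fun k' : K => (b, f b * k')) 1 (invMulD IB IK f b v)
        = (0, modelDeriv IB IK f b v) := by
      rw [modelDeriv_prodMk mdifferentiableAt_const (mdifferentiableAt_leftTranslation _ _),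
        modelDeriv_const, modelDeriv_mul_left_invMulD hf]
    rw [OneForm.apply_congr θ (p := (b, f b)) (p' := (b, f b * 1)) (by simp), ← h']
    exact h
  -- the part along the constant section `f b`, by equivariance
  have hequi : θ (b, f b) ((v, 0) : EB × EK) = lieAd IK (f b)⁻¹ (potential IB IK θ b v) := by
    have h := hθ.equivariant b hb 1 (f b) ((v, 0) : EB × EK)
    have hin : MDifferentiableAt IB (IB.prod IK) (fun b' : B => (b', (1 : K))) b :=
      mdifferentiableAt_id.prodMk mdifferentiableAt_const
    have hR : MDifferentiableAt (IB.prod IK) (IB.prod IK)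
        (fun p : B × K => (p.1, p.2 * f b)) (b, 1) :=
      mdifferentiableAt_fst.prodMk (mdifferentiableAt_snd.lieGroup_mul mdifferentiableAt_const)
    have h' : modelDeriv (IB.prod IK) (IB.prod IK) (fun p : B × K => (p.1, p.2 * f b)) (b, 1)
        (v, 0) = (v, 0) := by
      have h1 := modelDeriv_comp (b, 1) hR hin rfl v
      dsimp only at h1
      rw [modelDeriv_prodMk (f := fun x : B => x) mdifferentiableAt_id mdifferentiableAt_const,
        modelDeriv_prodMk (f := fun x : B => x) mdifferentiableAt_id mdifferentiableAt_const,
        modelDeriv_id, modelDeriv_const, modelDeriv_const] at h1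
      exact h1.symm
    rw [potential_apply, OneForm.apply_congr θ (p := (b, f b)) (p' := (b, 1 * f b)) (by simp),
      ← h]
    exact congrArg (fun w : EB × EK => θ (b, 1 * f b) w) h'.symm
  have hsplit : ((v, modelDeriv IB IK f b v) : EB × EK)
      = (v, 0) + (0, modelDeriv IB IK f b v) := by simp
  rw [← hequi, ← hfund, hsplit]
  exact map_add (θ (b, f b)) _ _

/-- At the unit a connection 1-form is its potential plus the identity on vertical vectors. -/
theorem IsConnectionForm.apply_one {S : Set B} {θ : OneForm (IB.prod IK) (B × K) EK}
    (hθ : IsConnectionForm IB IK S θ) {b : B} (hb : b ∈ S) (v : EB) (Z : EK) :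
    θ (b, 1) ((v, Z) : EB × EK) = potential IB IK θ b v + Z := by
  have h := hθ.fundamental b hb 1 Z
  have h' : modelDeriv IK (IB.prod IK) (fun k' : K => (b, 1 * k')) 1 Z = (0, Z) := by
    rw [modelDeriv_prodMk mdifferentiableAt_const (mdifferentiableAt_leftTranslation _ _),
      modelDeriv_const]
    simp only [one_mul, modelDeriv_id]
  have hvert : θ (b, 1) ((0, Z) : EB × EK) = Z := by
    rw [OneForm.apply_congr θ (p := (b, (1 : K))) (p' := (b, 1 * 1)) (by simp), ← h']
    exact h
  have hsplit : ((v, Z) : EB × EK) = (v, 0) + (0, Z) := by simp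
  rw [potential_apply, hsplit]
  exact (map_add (θ (b, 1)) _ _).trans (congrArg _ hvert)

/-- The horizontal lift of `v` at a point of the unit section. -/
theorem IsConnectionForm.horizontal_lift {S : Set B} {θ : OneForm (IB.prod IK) (B × K) EK}
    (hθ : IsConnectionForm IB IK S θ) {b : B} (hb : b ∈ S) (v : EB) :
    ((v, -potential IB IK θ b v) : EB × EK) ∈ horizontal IB IK θ (b, 1) :=
  (hθ.apply_one hb v _).trans (add_neg_cancel _)

/-- The change of gauge for the potentials of a connection on a glued principal bundle. -/
theorem IsGlobalConnection.potential_eq {ι : Type*} {S : ι → Set B} {c : ι → ι → B → K}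
    {θ : ι → OneForm (IB.prod IK) (B × K) EK} (hθ : IsGlobalConnection IB IK S c θ) {i j : ι}
    {b : B} (hb : b ∈ S i ∩ S j) (hc : MDifferentiableAt IB IK (c i j) b) (v : EB) :
    potential IB IK (θ j) b v
      = lieAd IK (c i j b)⁻¹ (potential IB IK (θ i) b v) + invMulD IB IK (c i j) b v := by
  have h := hθ.glue i j b hb 1 ((v, 0) : EB × EK)
  have hin : MDifferentiableAt IB (IB.prod IK) (fun b' : B => (b', (1 : K))) b :=
    mdifferentiableAt_id.prodMk mdifferentiableAt_const
  have hL : MDifferentiableAt (IB.prod IK) (IB.prod IK)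
      (fun p : B × K => (p.1, c i j p.1 * p.2)) (b, 1) :=
    mdifferentiableAt_fst.prodMk
      ((hc.comp (b, (1 : K)) mdifferentiableAt_fst).lieGroup_mul mdifferentiableAt_snd)
  have h' : modelDeriv (IB.prod IK) (IB.prod IK) (fun p : B × K => (p.1, c i j p.1 * p.2)) (b, 1)
      (v, 0) = (v, modelDeriv IB IK (c i j) b v) := by
    have h1 := modelDeriv_comp (b, 1) hL hin rfl v
    dsimp only at h1
    rw [modelDeriv_prodMk (f := fun x : B => x) mdifferentiableAt_id mdifferentiableAt_const,
      modelDeriv_prodMk (f := fun x : B => x) mdifferentiableAt_id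
        (hc.lieGroup_mul mdifferentiableAt_const),
      modelDeriv_id, modelDeriv_const] at h1
    simpa only [mul_one] using h1.symm
  rw [← (hθ.isConnection i).apply_graph hb.1 hc, potential_apply,
    OneForm.apply_congr (θ i) (p := (b, c i j b)) (p' := (b, c i j b * 1)) (by simp), ← h']
  exact h

end LieGroups

/-! ### The Lie group of arrows of a crossed module -/

namespace LieCrossedModule

variable {EG EH : Type*}
  [NormedAddCommGroup EG] [NormedSpace ℝ EG] [NormedAddCommGroup EH] [NormedSpace ℝ EH]
  {G : Type*} [TopologicalSpace G] [ChartedSpace EG G] [Group G] [LieGroup 𝓘(ℝ, EG) ∞ G]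
  {H : Type*} [TopologicalSpace H] [ChartedSpace EH H] [Group H] [LieGroup 𝓘(ℝ, EH) ∞ H]
  {EB : Type*} [NormedAddCommGroup EB] [NormedSpace ℝ EB]
  {HB : Type*} [TopologicalSpace HB] {IB : ModelWithCorners ℝ EB HB}
  {B : Type*} [TopologicalSpace B] [ChartedSpace HB B]
  (X : LieCrossedModule EG EH G H)

/-- The target homomorphism `(h, g) ↦ t(h) g` from `H ⋊ G` to `G`. -/
def targetHom (q : X.ArrowGroup) : G := X.t (X.left q) * X.right q

theorem targetHom_mul (q q' : X.ArrowGroup) :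
    X.targetHom (q * q') = X.targetHom q * X.targetHom q' := by
  change X.t (X.left q * X.α (X.right q) (X.left q')) * (X.right q * X.right q')
    = X.t (X.left q) * X.right q * (X.t (X.left q') * X.right q')
  rw [map_mul, X.equivariant]
  group

theorem mdifferentiable_left : MDifferentiable X.arrowModel 𝓘(ℝ, EH) X.left :=
  fun q => mdifferentiableAt_fst (I := 𝓘(ℝ, EH)) (I' := 𝓘(ℝ, EG)) (x := (q : H × G))

theorem mdifferentiable_right : MDifferentiable X.arrowModel 𝓘(ℝ, EG) X.right :=
  fun q => mdifferentiableAt_snd (I := 𝓘(ℝ, EH)) (I' := 𝓘(ℝ, EG)) (x := (q : H × G))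

theorem mdifferentiable_t : MDifferentiable 𝓘(ℝ, EH) 𝓘(ℝ, EG) X.t :=
  X.smooth_t.mdifferentiable (by simp)

theorem mdifferentiableAt_t_left (q : X.ArrowGroup) :
    MDifferentiableAt X.arrowModel 𝓘(ℝ, EG) (fun q => X.t (X.left q)) q :=
  (X.mdifferentiable_t _).comp q (X.mdifferentiable_left q)

theorem mdifferentiable_targetHom : MDifferentiable X.arrowModel 𝓘(ℝ, EG) X.targetHom :=
  fun q => (X.mdifferentiableAt_t_left q).lieGroup_mul (X.mdifferentiable_right q)

theorem mdifferentiableAt_pair {h : B → H} {g : B → G} {b : B}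
    (hh : MDifferentiableAt IB 𝓘(ℝ, EH) h b) (hg : MDifferentiableAt IB 𝓘(ℝ, EG) g b) :
    MDifferentiableAt IB X.arrowModel (fun b => X.pair (h b) (g b)) b :=
  hh.prodMk hg

theorem mdifferentiableAt_α {h : B → H} {g : B → G} {b : B}
    (hg : MDifferentiableAt IB 𝓘(ℝ, EG) g b) (hh : MDifferentiableAt IB 𝓘(ℝ, EH) h b) :
    MDifferentiableAt IB 𝓘(ℝ, EH) (fun b => X.α (g b) (h b)) b :=
  (X.smooth_α.contMDiffAt.mdifferentiableAt (by simp)).comp b (hg.prodMk hh)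

theorem modelDeriv_left (q : X.ArrowGroup) (Z : EH × EG) :
    modelDeriv X.arrowModel 𝓘(ℝ, EH) X.left q Z = Z.1 :=
  modelDeriv_fst (I := 𝓘(ℝ, EH)) (I' := 𝓘(ℝ, EG)) (q : H × G) Z

theorem modelDeriv_right (q : X.ArrowGroup) (Z : EH × EG) :
    modelDeriv X.arrowModel 𝓘(ℝ, EG) X.right q Z = Z.2 :=
  modelDeriv_snd (I := 𝓘(ℝ, EH)) (I' := 𝓘(ℝ, EG)) (q : H × G) Z

theorem modelDeriv_targetHom (Z : EH × EG) :
    modelDeriv X.arrowModel 𝓘(ℝ, EG) X.targetHom 1 Z = X.tLie Z.1 + Z.2 := by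
  have h := modelDeriv_mul_of_eq_one (X.mdifferentiableAt_t_left 1) (X.mdifferentiable_right 1)
    (map_one X.t) rfl Z
  rw [modelDeriv_right, modelDeriv_comp (1 : H) (X.mdifferentiable_t 1) (X.mdifferentiable_left 1)
    rfl, modelDeriv_left] at h
  exact h

theorem mdifferentiable_pair_one :
    MDifferentiable 𝓘(ℝ, EG) X.arrowModel (fun k : G => X.pair 1 k) :=
  fun _ => X.mdifferentiableAt_pair mdifferentiableAt_const mdifferentiableAt_id

theorem modelDeriv_pair_one (Y : EG) (k : G) :
    modelDeriv 𝓘(ℝ, EG) X.arrowModel (fun k : G => X.pair 1 k) k Y = (0, Y) := by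
  have h := modelDeriv_prodMk (I := 𝓘(ℝ, EG)) (I' := 𝓘(ℝ, EH)) (I'' := 𝓘(ℝ, EG))
    (f := fun _ : G => (1 : H)) (g := fun k : G => k) (x := k)
    mdifferentiableAt_const mdifferentiableAt_id Y
  rw [modelDeriv_const, modelDeriv_id] at h
  exact h

theorem pair_one_mul (k k' : G) : X.pair 1 (k * k') = X.pair 1 k * X.pair 1 k' := by
  rw [pair_mul_pair, map_one, mul_one]

theorem inv_pair (h : H) (g : G) : (X.pair h g)⁻¹ = X.pair (X.α g⁻¹ h⁻¹) g⁻¹ := rfl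

/-- The `𝔥`-component of `Ad((h, g)⁻¹)`, transported by `α_g`. -/
theorem αAct_lieAd_inv (h : H) (g : G) (Z : EH × EG) :
    X.αAct g (lieAd X.arrowModel (X.pair h g)⁻¹ Z).1
      = lieAd 𝓘(ℝ, EH) h⁻¹ Z.1 + X.invMulαLie h Z.2 := by
  have hα : ∀ k : H, MDifferentiableAt 𝓘(ℝ, EH) 𝓘(ℝ, EH) (fun h : H => X.α g h) k :=
    fun k => X.mdifferentiableAt_α mdifferentiableAt_const mdifferentiableAt_id
  have hβ : MDifferentiableAt 𝓘(ℝ, EG) 𝓘(ℝ, EH) (fun g : G => h⁻¹ * X.α g h) 1 :=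
    (X.mdifferentiableAt_α mdifferentiableAt_id mdifferentiableAt_const).lieGroup_const_mul _
  have hconj := mdifferentiableAt_conj (IK := X.arrowModel) (X.pair h g)⁻¹ 1
  have hleft : MDifferentiableAt X.arrowModel 𝓘(ℝ, EH)
      (fun z : X.ArrowGroup => X.left ((X.pair h g)⁻¹ * z * (X.pair h g)⁻¹⁻¹)) 1 :=
    (X.mdifferentiable_left _).comp 1 hconj
  have hfst : MDifferentiableAt X.arrowModel 𝓘(ℝ, EH)
      (fun z : X.ArrowGroup => h⁻¹ * X.left z * h⁻¹⁻¹) 1 :=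
    (mdifferentiableAt_conj (IK := 𝓘(ℝ, EH)) h⁻¹ _).comp 1 (X.mdifferentiable_left 1)
  have hsnd : MDifferentiableAt X.arrowModel 𝓘(ℝ, EH)
      (fun z : X.ArrowGroup => h⁻¹ * X.α (X.right z) h) 1 :=
    MDifferentiableAt.comp (g := fun g : G => h⁻¹ * X.α g h) (1 : X.ArrowGroup) hβ
      (X.mdifferentiable_right 1)
  -- `α_g` turns the `H`-component of conjugation by `(h, g)⁻¹` into a product of two maps into `H`,
  -- both equal to `1` at `z = 1`
  have key : (fun z : X.ArrowGroup => X.α g (X.left ((X.pair h g)⁻¹ * z * (X.pair h g)⁻¹⁻¹)))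
      = fun z => (h⁻¹ * X.left z * h⁻¹⁻¹) * (h⁻¹ * X.α (X.right z) h) := by
    funext z
    obtain ⟨a, b, rfl⟩ : ∃ a b, z = X.pair a b := ⟨_, _, (X.pair_left_right z).symm⟩
    rw [inv_inv, inv_inv, inv_pair, pair_mul_pair, pair_mul_pair]
    simp only [left_pair, right_pair, map_mul]
    simp [mul_assoc]
  have h1 : X.αAct g (lieAd X.arrowModel (X.pair h g)⁻¹ Z).1
      = modelDeriv X.arrowModel 𝓘(ℝ, EH)
        (fun z : X.ArrowGroup => X.α g (X.left ((X.pair h g)⁻¹ * z * (X.pair h g)⁻¹⁻¹))) 1 Z := by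
    rw [modelDeriv_comp (g := fun h : H => X.α g h) (1 : H) (hα 1) hleft
      (by simp; rfl),
      modelDeriv_comp (1 : X.ArrowGroup) (X.mdifferentiable_left 1) hconj (by simp),
      modelDeriv_left]
    rfl
  rw [h1, key, modelDeriv_mul_of_eq_one hfst hsnd
      (by change h⁻¹ * 1 * h⁻¹⁻¹ = 1; simp) (by change h⁻¹ * X.α 1 h = 1; simp)]
  have h2 := modelDeriv_comp (1 : H) (mdifferentiableAt_conj (IK := 𝓘(ℝ, EH)) h⁻¹ _)
    (X.mdifferentiable_left 1) rfl Z
  have h3 := modelDeriv_comp (1 : G) hβ (X.mdifferentiable_right 1) rfl Z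
  rw [modelDeriv_left] at h2
  rw [modelDeriv_right] at h3
  exact congrArg₂ _ h2 h3

/-- The `𝔥`-component of `q⁻¹ dq` for `q = (h, g)`, transported by `α_g`, is `h⁻¹ dh`. -/
theorem αAct_invMulD {h : B → H} {g : B → G} {b : B}
    (hh : MDifferentiableAt IB 𝓘(ℝ, EH) h b) (hg : MDifferentiableAt IB 𝓘(ℝ, EG) g b) (v : EB) :
    X.αAct (g b) (invMulD IB X.arrowModel (fun b => X.pair (h b) (g b)) b v : EH × EG).1
      = invMulD IB 𝓘(ℝ, EH) h b v := by
  have hα : MDifferentiableAt 𝓘(ℝ, EH) 𝓘(ℝ, EH) (fun k : H => X.α (g b) k) 1 :=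
    X.mdifferentiableAt_α mdifferentiableAt_const mdifferentiableAt_id
  have hq := (X.mdifferentiableAt_pair hh hg).lieGroup_const_mul (X.pair (h b) (g b))⁻¹
  have hleft : MDifferentiableAt IB 𝓘(ℝ, EH)
      (fun b' => X.left ((X.pair (h b) (g b))⁻¹ * X.pair (h b') (g b'))) b :=
    (X.mdifferentiable_left _).comp b hq
  have key : (fun b' => X.α (g b) (X.left ((X.pair (h b) (g b))⁻¹ * X.pair (h b') (g b'))))
      = fun b' => (h b)⁻¹ * h b' := by
    funext b'
    rw [inv_pair, pair_mul_pair]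
    simp only [left_pair, map_mul]
    simp
  rw [invMulD_apply h, ← key,
    modelDeriv_comp (g := fun k : H => X.α (g b) k) (1 : H) hα hleft (by simp; rfl),
    modelDeriv_comp (1 : X.ArrowGroup) (X.mdifferentiable_left 1) hq (by simp), modelDeriv_left]
  rfl

end LieCrossedModule

/-! ### Linkable pairs -/

theorem LinkedPair.isLinked {M : Type*} {R : M → M → Prop} (n : LinkedPair R) :
    IsLinked R [n.y, n.x] :=
  ⟨by simp, by simp only [List.isChain_cons_cons, List.isChain_singleton, and_true]; exact n.2⟩

section TwoBundles

variable {EM EN EA : Type*}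
  [NormedAddCommGroup EM] [NormedSpace ℝ EM] [NormedAddCommGroup EN] [NormedSpace ℝ EN]
  [NormedAddCommGroup EA] [NormedSpace ℝ EA]
  {M : Type*} [TopologicalSpace M] [ChartedSpace EM M] [IsManifold 𝓘(ℝ, EM) ∞ M]
  {R : M → M → Prop} [TopologicalSpace (LinkedPair R)] [ChartedSpace EN (LinkedPair R)]
  [IsManifold 𝓘(ℝ, EN) ∞ (LinkedPair R)]
  {A : Type*} [TopologicalSpace A] [ChartedSpace EA A] [IsManifold 𝓘(ℝ, EA) ∞ A]
  {EG EH : Type*}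
  [NormedAddCommGroup EG] [NormedSpace ℝ EG] [NormedAddCommGroup EH] [NormedSpace ℝ EH]
  {G : Type*} [TopologicalSpace G] [ChartedSpace EG G] [Group G] [LieGroup 𝓘(ℝ, EG) ∞ G]
  {H : Type*} [TopologicalSpace H] [ChartedSpace EH H] [Group H] [LieGroup 𝓘(ℝ, EH) ∞ H]
  {ι : Type*}

namespace AffineTwoSpace

theorem src_pair (𝓜 : AffineTwoSpace EM EN EA R A) (n : LinkedPair R) :
    𝓜.src (𝓜.φ [n.y, n.x]) = n.x :=
  𝓜.src_φ [n.y] n.x (n.isLinked)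

theorem tgt_pair (𝓜 : AffineTwoSpace EM EN EA R A) (n : LinkedPair R) :
    𝓜.tgt (𝓜.φ [n.y, n.x]) = n.y :=
  𝓜.tgt_φ n.y [n.x] (n.isLinked)

/-- The source projection of linkable pairs factors through the arrows. -/
theorem contMDiff_x (𝓜 : AffineTwoSpace EM EN EA R A) :
    ContMDiff 𝓘(ℝ, EN) 𝓘(ℝ, EM) ∞ (LinkedPair.x (R := R)) :=
  (𝓜.smooth_src.comp 𝓜.smooth_pair).congr fun n => (𝓜.src_pair n).symm

theorem contMDiff_y (𝓜 : AffineTwoSpace EM EN EA R A) :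
    ContMDiff 𝓘(ℝ, EN) 𝓘(ℝ, EM) ∞ (LinkedPair.y (R := R)) :=
  (𝓜.smooth_tgt.comp 𝓜.smooth_pair).congr fun n => (𝓜.tgt_pair n).symm

theorem mdifferentiable_x (𝓜 : AffineTwoSpace EM EN EA R A) :
    MDifferentiable 𝓘(ℝ, EN) 𝓘(ℝ, EM) (LinkedPair.x (R := R)) :=
  𝓜.contMDiff_x.mdifferentiable (by simp)

theorem mdifferentiable_y (𝓜 : AffineTwoSpace EM EN EA R A) :
    MDifferentiable 𝓘(ℝ, EN) 𝓘(ℝ, EM) (LinkedPair.y (R := R)) :=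
  𝓜.contMDiff_y.mdifferentiable (by simp)

theorem mdifferentiable_diag (𝓜 : AffineTwoSpace EM EN EA R A) :
    MDifferentiable 𝓘(ℝ, EM) 𝓘(ℝ, EN) 𝓜.diag :=
  𝓜.smooth_diag.mdifferentiable (by simp)

theorem modelDeriv_x_diag (𝓜 : AffineTwoSpace EM EN EA R A) (x : M) (w : EM) :
    modelDeriv 𝓘(ℝ, EN) 𝓘(ℝ, EM) LinkedPair.x (𝓜.diag x)
      (modelDeriv 𝓘(ℝ, EM) 𝓘(ℝ, EN) 𝓜.diag x w) = w :=
  (modelDeriv_comp _ (𝓜.mdifferentiable_x _) (𝓜.mdifferentiable_diag x) rfl w).symm.trans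
    (modelDeriv_id x w)

theorem modelDeriv_y_diag (𝓜 : AffineTwoSpace EM EN EA R A) (x : M) (w : EM) :
    modelDeriv 𝓘(ℝ, EN) 𝓘(ℝ, EM) LinkedPair.y (𝓜.diag x)
      (modelDeriv 𝓘(ℝ, EM) 𝓘(ℝ, EN) 𝓜.diag x w) = w :=
  (modelDeriv_comp _ (𝓜.mdifferentiable_y _) (𝓜.mdifferentiable_diag x) rfl w).symm.trans
    (modelDeriv_id x w)

theorem isOpen_pairsIn (𝓜 : AffineTwoSpace EM EN EA R A) {S : Set M} (hS : IsOpen S) :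
    IsOpen (pairsIn R S) :=
  (hS.preimage 𝓜.contMDiff_y.continuous).inter (hS.preimage 𝓜.contMDiff_x.continuous)

theorem pair_mem_sub (𝓜 : AffineTwoSpace EM EN EA R A) {S : Set M} {n : LinkedPair R}
    (hn : n ∈ pairsIn R S) : 𝓜.φ [n.y, n.x] ∈ (𝓜.sub S).arr :=
  ⟨_, n.isLinked, by simpa using (show n.y ∈ S ∧ n.x ∈ S from hn), rfl⟩

theorem sub_arr_mono (𝓜 : AffineTwoSpace EM EN EA R A) {S T : Set M} (h : S ⊆ T) :
    (𝓜.sub S).arr ⊆ (𝓜.sub T).arr :=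
  fun _ ⟨l, hl, hS, hf⟩ => ⟨l, hl, fun z hz => h (hS z hz), hf⟩

end AffineTwoSpace

/-! ### Transition functions -/

variable {𝓜 : AffineTwoSpace EM EN EA R A} {X : LieCrossedModule EG EH G H}
  {U : ι → Set M} {PO PA : Type*}

namespace IsTransition

variable {𝓟 : TwoBundle 𝓜 X U PO PA} {g : ι → ι → M → G} {h : ι → ι → M → M → H}

theorem mdifferentiableAt_g (hgh : IsTransition 𝓟 g h) (hU : IsGoodCover U) {i j : ι} {x : M}
    (hx : x ∈ U i ∩ U j) : MDifferentiableAt 𝓘(ℝ, EM) 𝓘(ℝ, EG) (g i j) x :=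
  ((hgh.smooth_g i j).contMDiffAt
    (((hU.isOpen i).inter (hU.isOpen j)).mem_nhds hx)).mdifferentiableAt (by simp)

theorem mdifferentiableAt_h (hgh : IsTransition 𝓟 g h) (hU : IsGoodCover U) {i j : ι}
    {n : LinkedPair R} (hn : n ∈ pairsIn R (U i ∩ U j)) :
    MDifferentiableAt 𝓘(ℝ, EN) 𝓘(ℝ, EH) (fun n : LinkedPair R => h i j n.y n.x) n :=
  ((hgh.smooth_h i j).contMDiffAt
    ((𝓜.isOpen_pairsIn ((hU.isOpen i).inter (hU.isOpen j))).mem_nhds hn)).mdifferentiableAt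
    (by simp)

theorem mdifferentiableAt_g_x (hgh : IsTransition 𝓟 g h) (hU : IsGoodCover U) {i j : ι}
    {n : LinkedPair R} (hn : n ∈ pairsIn R (U i ∩ U j)) :
    MDifferentiableAt 𝓘(ℝ, EN) 𝓘(ℝ, EG) (fun n : LinkedPair R => g i j n.x) n :=
  (hgh.mdifferentiableAt_g hU hn.2).comp n (𝓜.mdifferentiable_x n)

theorem mdifferentiableAt_q (hgh : IsTransition 𝓟 g h) (hU : IsGoodCover U) {i j : ι}
    {n : LinkedPair R} (hn : n ∈ pairsIn R (U i ∩ U j)) :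
    MDifferentiableAt 𝓘(ℝ, EN) X.arrowModel (qTransition R X g h i j) n :=
  X.mdifferentiableAt_pair (hgh.mdifferentiableAt_h hU hn) (hgh.mdifferentiableAt_g_x hU hn)

/-- The trivialization `φ^j` covers the identity of `𝓜` on arrows. -/
theorem πA_φA (hgh : IsTransition 𝓟 g h) {j : ι} {f : A} (hf : f ∈ (𝓜.sub (U j)).arr)
    (q : X.ArrowGroup) : 𝓟.πA (𝓟.φA j (f, q)) = f := by
  rw [← 𝓟.fst_φA' j _ ((𝓟.φ_functor j).arr_mem (f, q) hf),
    hgh.map_arr j j f (by rwa [inter_self])]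

theorem φA_mem (hgh : IsTransition 𝓟 g h) {i j : ι} {f : A}
    (hf : f ∈ (𝓜.sub (U i ∩ U j)).arr) (q : X.ArrowGroup) :
    𝓟.φA j (f, q) ∈ ((𝓜.sub (U i)).preimage 𝓟.functor).arr := by
  change 𝓟.πA (𝓟.φA j (f, q)) ∈ (𝓜.sub (U i)).arr
  rw [hgh.πA_φA (𝓜.sub_arr_mono inter_subset_right hf)]
  exact 𝓜.sub_arr_mono inter_subset_left hf

/-- Functoriality of the change of trivialization with respect to targets:
`t(h^{ij}(y, x)) g^{ij}(x) = g^{ij}(y)`. -/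
theorem targetHom_q (hgh : IsTransition 𝓟 g h) {i j : ι} {n : LinkedPair R}
    (hn : n ∈ pairsIn R (U i ∩ U j)) :
    X.targetHom (qTransition R X g h i j n) = g i j n.y := by
  have hf := 𝓜.pair_mem_sub hn
  have h1 := (𝓟.φ'_functor i).map_tgt _ (hgh.φA_mem hf 1)
  rw [(𝓟.φ_functor j).map_tgt (𝓜.φ [n.y, n.x], 1) (𝓜.sub_arr_mono inter_subset_right hf),
    hgh.map_arr i j _ hf, mul_one, 𝓜.tgt_pair, 𝓜.src_pair] at h1
  have h2 := hgh.map_obj i j n.y hn.1 1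
  have h3 : ((𝓜.toArrowCategory.prod X.category).tgt (𝓜.φ [n.y, n.x], (1 : X.ArrowGroup)))
      = (n.y, 1) := by
    refine Prod.ext (𝓜.tgt_pair n) ?_
    change X.t 1 * 1 = 1
    simp
  rw [h3, h2, mul_one] at h1
  exact congrArg Prod.snd h1

/-- Functoriality of the change of trivialization with respect to identities. -/
theorem h_self (hgh : IsTransition 𝓟 g h) {i j : ι} {x : M} (hx : x ∈ U i ∩ U j) :
    h i j x x = 1 := by
  have hf := (𝓜.sub (U i ∩ U j)).idn_mem x hx
  have h1 := (𝓟.φ_functor j).map_idn (x, 1) hx.2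
  have hmem : 𝓟.φO j (x, 1) ∈ ((𝓜.sub (U i)).preimage 𝓟.functor).obj := by
    have h4 := ((𝓜.sub (U i)).preimage 𝓟.functor).src_mem _ (hgh.φA_mem hf 1)
    have h5 := (𝓟.φ_functor j).map_src (𝓜.idn x, 1) (𝓜.sub_arr_mono inter_subset_right hf)
    rw [h5] at h4
    have h6 : (𝓜.toArrowCategory.prod X.category).src (𝓜.idn x, (1 : X.ArrowGroup)) = (x, 1) :=
      Prod.ext (𝓜.src_idn x) rfl
    rwa [h6] at h4
  have h2 := (𝓟.φ'_functor i).map_idn _ hmem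
  rw [← h1, hgh.map_obj i j x hx] at h2
  have h3 := (hgh.map_arr i j (𝓜.idn x) hf 1).symm.trans h2
  rw [𝓜.src_idn, 𝓜.tgt_idn, mul_one] at h3
  exact congrArg (fun a : A × X.ArrowGroup => X.left a.2) h3

end IsTransition

/-! ### Potentials of compatible connections -/

namespace IsCompatiblePair

variable {S : Set M} {θP : OneForm (𝓘(ℝ, EM).prod 𝓘(ℝ, EG)) (M × G) EG}
  {θQ : OneForm (𝓘(ℝ, EN).prod X.arrowModel) (LinkedPair R × X.ArrowGroup) (EH × EG)}

/-- Compatibility with the source map: the `𝔤`-component of the potential on pairs is `A(x)`. -/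
theorem potential_snd (hc : IsCompatiblePair 𝓜 X S θP θQ)
    (hP : IsConnectionForm 𝓘(ℝ, EM) 𝓘(ℝ, EG) S θP)
    (hQ : IsConnectionForm 𝓘(ℝ, EN) X.arrowModel (pairsIn R S) θQ)
    {n : LinkedPair R} (hn : n ∈ pairsIn R S) (v : EN) :
    (potential 𝓘(ℝ, EN) X.arrowModel θQ n v : EH × EG).2
      = OneForm.atSource (potential 𝓘(ℝ, EM) 𝓘(ℝ, EG) θP) n v := by
  set Z : EH × EG := potential 𝓘(ℝ, EN) X.arrowModel θQ n v with hZ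
  have hhor := (hc.source (n, 1) hn).subset (mem_image_of_mem _ (hQ.horizontal_lift hn v))
  have hD : modelDeriv (𝓘(ℝ, EN).prod X.arrowModel) (𝓘(ℝ, EM).prod 𝓘(ℝ, EG))
      (fun q : LinkedPair R × X.ArrowGroup => (q.1.x, X.right q.2)) (n, 1) (v, -Z)
      = (modelDeriv 𝓘(ℝ, EN) 𝓘(ℝ, EM) LinkedPair.x n v, -Z.2) := by
    rw [modelDeriv_prodMk
      (f := fun q : LinkedPair R × X.ArrowGroup => q.1.x) (g := fun q => X.right q.2)
      (MDifferentiableAt.comp (g := LinkedPair.x) (n, (1 : X.ArrowGroup))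
        (𝓜.mdifferentiable_x n) mdifferentiableAt_fst)
      ((X.mdifferentiable_right 1).comp (n, (1 : X.ArrowGroup)) mdifferentiableAt_snd),
      modelDeriv_comp n (𝓜.mdifferentiable_x n) mdifferentiableAt_fst rfl,
      modelDeriv_comp (1 : X.ArrowGroup) (X.mdifferentiable_right 1) mdifferentiableAt_snd rfl,
      modelDeriv_fst, modelDeriv_snd, X.modelDeriv_right]
    rfl
  have h0 : θP (n.x, 1) ((modelDeriv 𝓘(ℝ, EN) 𝓘(ℝ, EM) LinkedPair.x n v, -Z.2) : EM × EG) = 0 :=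
    hD ▸ hhor
  rw [hP.apply_one hn.2] at h0
  exact (eq_of_sub_eq_zero (by rw [sub_eq_add_neg]; exact h0)).symm

/-- Compatibility with the target map: `t^Lie` of the `𝔥`-component plus the `𝔤`-component of the
potential on pairs is `A(y)`. -/
theorem targetHom_potential (hc : IsCompatiblePair 𝓜 X S θP θQ)
    (hP : IsConnectionForm 𝓘(ℝ, EM) 𝓘(ℝ, EG) S θP)
    (hQ : IsConnectionForm 𝓘(ℝ, EN) X.arrowModel (pairsIn R S) θQ)
    {n : LinkedPair R} (hn : n ∈ pairsIn R S) (v : EN) :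
    modelDeriv X.arrowModel 𝓘(ℝ, EG) X.targetHom 1 (potential 𝓘(ℝ, EN) X.arrowModel θQ n v)
      = OneForm.atTarget (potential 𝓘(ℝ, EM) 𝓘(ℝ, EG) θP) n v := by
  set Z : EH × EG := potential 𝓘(ℝ, EN) X.arrowModel θQ n v with hZ
  have hhor := (hc.target (n, 1) hn).subset (mem_image_of_mem _ (hQ.horizontal_lift hn v))
  have hD : modelDeriv (𝓘(ℝ, EN).prod X.arrowModel) (𝓘(ℝ, EM).prod 𝓘(ℝ, EG))
      (fun q : LinkedPair R × X.ArrowGroup => (q.1.y, X.targetHom q.2)) (n, 1) (v, -Z)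
      = (modelDeriv 𝓘(ℝ, EN) 𝓘(ℝ, EM) LinkedPair.y n v,
          -modelDeriv X.arrowModel 𝓘(ℝ, EG) X.targetHom 1 Z) := by
    rw [modelDeriv_prodMk
      (f := fun q : LinkedPair R × X.ArrowGroup => q.1.y) (g := fun q => X.targetHom q.2)
      (MDifferentiableAt.comp (g := LinkedPair.y) (n, (1 : X.ArrowGroup))
        (𝓜.mdifferentiable_y n) mdifferentiableAt_fst)
      ((X.mdifferentiable_targetHom 1).comp (n, (1 : X.ArrowGroup)) mdifferentiableAt_snd),
      modelDeriv_comp n (𝓜.mdifferentiable_y n) mdifferentiableAt_fst rfl,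
      modelDeriv_comp (1 : X.ArrowGroup) (X.mdifferentiable_targetHom 1) mdifferentiableAt_snd rfl,
      modelDeriv_fst, modelDeriv_snd, map_neg]
  have h0 : θP (n.y, X.targetHom 1) ((modelDeriv 𝓘(ℝ, EN) 𝓘(ℝ, EM) LinkedPair.y n v,
      -modelDeriv X.arrowModel 𝓘(ℝ, EG) X.targetHom 1 Z) : EM × EG) = 0 :=
    hD ▸ hhor
  have hone : X.targetHom 1 = 1 := map_one (MonoidHom.mk' X.targetHom X.targetHom_mul)
  rw [OneForm.apply_congr θP (p := (n.y, X.targetHom 1)) (p' := (n.y, 1)) (by rw [hone]),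
    hP.apply_one hn.1] at h0
  exact (eq_of_sub_eq_zero (by rw [sub_eq_add_neg]; exact h0)).symm

/-- Compatibility with the identity map: along the diagonal the potential on pairs is `A`. -/
theorem potential_diag (hc : IsCompatiblePair 𝓜 X S θP θQ)
    (hP : IsConnectionForm 𝓘(ℝ, EM) 𝓘(ℝ, EG) S θP)
    (hQ : IsConnectionForm 𝓘(ℝ, EN) X.arrowModel (pairsIn R S) θQ)
    {x : M} (hx : x ∈ S) (w : EM) :
    potential 𝓘(ℝ, EN) X.arrowModel θQ (𝓜.diag x) (modelDeriv 𝓘(ℝ, EM) 𝓘(ℝ, EN) 𝓜.diag x w)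
      = ((0, potential 𝓘(ℝ, EM) 𝓘(ℝ, EG) θP x w) : EH × EG) := by
  set Y : EG := potential 𝓘(ℝ, EM) 𝓘(ℝ, EG) θP x w with hY
  have hhor := hc.identity (x, 1) hx (mem_image_of_mem _ (hP.horizontal_lift hx w))
  have hD : modelDeriv (𝓘(ℝ, EM).prod 𝓘(ℝ, EG)) (𝓘(ℝ, EN).prod X.arrowModel)
      (fun p : M × G => (𝓜.diag p.1, X.pair 1 p.2)) (x, 1) (w, -Y)
      = (modelDeriv 𝓘(ℝ, EM) 𝓘(ℝ, EN) 𝓜.diag x w, (0, -Y)) := by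
    rw [modelDeriv_prodMk
      (f := fun p : M × G => 𝓜.diag p.1) (g := fun p => X.pair 1 p.2)
      ((𝓜.mdifferentiable_diag x).comp (x, (1 : G)) mdifferentiableAt_fst)
      ((X.mdifferentiable_pair_one 1).comp (x, (1 : G)) mdifferentiableAt_snd),
      modelDeriv_comp x (𝓜.mdifferentiable_diag x) mdifferentiableAt_fst rfl,
      modelDeriv_comp (1 : G) (X.mdifferentiable_pair_one 1) mdifferentiableAt_snd rfl,
      modelDeriv_fst, modelDeriv_snd, X.modelDeriv_pair_one]
  have h0 : θQ (𝓜.diag x, 1)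
      ((modelDeriv 𝓘(ℝ, EM) 𝓘(ℝ, EN) 𝓜.diag x w, ((0, -Y) : EH × EG)) : EN × EH × EG) = 0 :=
    hD ▸ hhor
  rw [hQ.apply_one (b := 𝓜.diag x) ⟨hx, hx⟩] at h0
  refine (eq_neg_of_add_eq_zero_left h0).trans ?_
  simp

end IsCompatiblePair

/-! ### The gauge transform of a potential on pairs -/

namespace IsTransition

variable {𝓟 : TwoBundle 𝓜 X U PO PA} {g : ι → ι → M → G} {h : ι → ι → M → M → H}

/-- The source homomorphism `H ⋊ G → G` takes `q⁻¹ dq` to the pull-back of `g⁻¹ dg` at `x`. -/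
theorem invMulD_q_snd (hgh : IsTransition 𝓟 g h) (hU : IsGoodCover U) {i j : ι}
    {n : LinkedPair R} (hn : n ∈ pairsIn R (U i ∩ U j)) (v : EN) :
    (invMulD 𝓘(ℝ, EN) X.arrowModel (qTransition R X g h i j) n v : EH × EG).2
      = invMulD 𝓘(ℝ, EM) 𝓘(ℝ, EG) (g i j) n.x (modelDeriv 𝓘(ℝ, EN) 𝓘(ℝ, EM) LinkedPair.x n v) := by
  rw [← invMulD_comp (hgh.mdifferentiableAt_g hU hn.2) (𝓜.mdifferentiable_x n),
    ← X.modelDeriv_right 1]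
  exact modelDeriv_hom_invMulD X.right X.mdifferentiable_right (fun _ _ => rfl)
    (hgh.mdifferentiableAt_q hU hn) v

/-- The target homomorphism `H ⋊ G → G` takes `q⁻¹ dq` to the pull-back of `g⁻¹ dg` at `y`. -/
theorem targetHom_invMulD_q (hgh : IsTransition 𝓟 g h) (hU : IsGoodCover U) {i j : ι}
    {n : LinkedPair R} (hn : n ∈ pairsIn R (U i ∩ U j)) (v : EN) :
    modelDeriv X.arrowModel 𝓘(ℝ, EG) X.targetHom 1
        (invMulD 𝓘(ℝ, EN) X.arrowModel (qTransition R X g h i j) n v)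
      = invMulD 𝓘(ℝ, EM) 𝓘(ℝ, EG) (g i j) n.y (modelDeriv 𝓘(ℝ, EN) 𝓘(ℝ, EM) LinkedPair.y n v) := by
  rw [← invMulD_comp (hgh.mdifferentiableAt_g hU hn.1) (𝓜.mdifferentiable_y n),
    modelDeriv_hom_invMulD X.targetHom X.mdifferentiable_targetHom X.targetHom_mul
      (hgh.mdifferentiableAt_q hU hn)]
  refine congrArg (fun T : EN →L[ℝ] EG => T v) (invMulD_congr ?_)
  filter_upwards [(𝓜.isOpen_pairsIn ((hU.isOpen i).inter (hU.isOpen j))).mem_nhds hn] with m hm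
  exact hgh.targetHom_q hm

/-- Along the diagonal `q⁻¹ dq` has no `𝔥`-component, because `h^{ij}(x, x) = 1`. -/
theorem invMulD_q_diag (hgh : IsTransition 𝓟 g h) (hU : IsGoodCover U) {i j : ι}
    {x : M} (hx : x ∈ U i ∩ U j) (w : EM) :
    (invMulD 𝓘(ℝ, EN) X.arrowModel (qTransition R X g h i j) (𝓜.diag x)
      (modelDeriv 𝓘(ℝ, EM) 𝓘(ℝ, EN) 𝓜.diag x w) : EH × EG).1 = 0 := by
  rw [← invMulD_comp (hgh.mdifferentiableAt_q hU (n := 𝓜.diag x) ⟨hx, hx⟩)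
    (𝓜.mdifferentiable_diag x)]
  have hq : (fun x' => qTransition R X g h i j (𝓜.diag x'))
      =ᶠ[nhds x] fun x' => X.pair 1 (g i j x') := by
    filter_upwards [((hU.isOpen i).inter (hU.isOpen j)).mem_nhds hx] with z hz
    exact congrArg (X.pair · (g i j z)) (hgh.h_self hz)
  rw [invMulD_congr hq, ← modelDeriv_hom_invMulD (fun k : G => X.pair 1 k)
    X.mdifferentiable_pair_one X.pair_one_mul (hgh.mdifferentiableAt_g hU hx),
    X.modelDeriv_pair_one]

theorem lieAd_q_diag (hgh : IsTransition 𝓟 g h) {i j : ι} {x : M} (hx : x ∈ U i ∩ U j) (Y : EG) :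
    (lieAd X.arrowModel (qTransition R X g h i j (𝓜.diag x))⁻¹ ((0, Y) : EH × EG)).1 = 0 := by
  have hq : (qTransition R X g h i j (𝓜.diag x))⁻¹ = X.pair 1 (g i j x)⁻¹ := by
    have h1 : qTransition R X g h i j (𝓜.diag x) = X.pair 1 (g i j x) :=
      congrArg (X.pair · (g i j x)) (hgh.h_self hx)
    rw [h1, X.inv_pair, inv_one, map_one]
  rw [hq, ← X.modelDeriv_pair_one Y 1, ← modelDeriv_hom_lieAd (fun k : G => X.pair 1 k)
    X.mdifferentiable_pair_one X.pair_one_mul, X.modelDeriv_pair_one]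

end IsTransition

end TwoBundles

/-! ### Transformation laws of the gauge potentials -/

theorem mainTheorem12
    {EM EN EA EG EH : Type*}
    [NormedAddCommGroup EM] [NormedSpace ℝ EM] [FiniteDimensional ℝ EM]
    [NormedAddCommGroup EN] [NormedSpace ℝ EN] [FiniteDimensional ℝ EN]
    [NormedAddCommGroup EA] [NormedSpace ℝ EA] [FiniteDimensional ℝ EA]
    [NormedAddCommGroup EG] [NormedSpace ℝ EG] [FiniteDimensional ℝ EG]
    [NormedAddCommGroup EH] [NormedSpace ℝ EH] [FiniteDimensional ℝ EH]
    -- the affine 2-space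
    {M : Type*} [TopologicalSpace M] [ChartedSpace EM M] [IsManifold 𝓘(ℝ, EM) ∞ M]
    {R : M → M → Prop} [TopologicalSpace (LinkedPair R)] [ChartedSpace EN (LinkedPair R)]
    [IsManifold 𝓘(ℝ, EN) ∞ (LinkedPair R)]
    {A : Type*} [TopologicalSpace A] [ChartedSpace EA A] [IsManifold 𝓘(ℝ, EA) ∞ A]
    (𝓜 : AffineTwoSpace EM EN EA R A)
    -- the Lie crossed module
    {G : Type*} [TopologicalSpace G] [ChartedSpace EG G] [Group G] [LieGroup 𝓘(ℝ, EG) ∞ G]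
    {H : Type*} [TopologicalSpace H] [ChartedSpace EH H] [Group H] [LieGroup 𝓘(ℝ, EH) ∞ H]
    (X : LieCrossedModule EG EH G H)
    -- the principal 2-bundle and its transition functions
    {ι : Type*} (U : ι → Set M) (hU : IsGoodCover U)
    {PO PA : Type*} (𝓟 : TwoBundle 𝓜 X U PO PA)
    (g : ι → ι → M → G) (h : ι → ι → M → M → H) (hgh : IsTransition 𝓟 g h) :
    -- the case of a trivial 2-bundle
    (IsTrivialTwoBundle 𝓟 g →
      ∀ (θP : ι → OneForm (𝓘(ℝ, EM).prod 𝓘(ℝ, EG)) (M × G) EG)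
        (θQ : ι → OneForm (𝓘(ℝ, EN).prod X.arrowModel) (LinkedPair R × X.ArrowGroup) (EH × EG)),
      IsTrivialTwoConnection 𝓜 U g h θP θQ →
      ∀ (Apot : ι → OneForm 𝓘(ℝ, EM) M EG)
        (ηfull : ι → OneForm 𝓘(ℝ, EN) (LinkedPair R) (EH × EG))
        (η : ι → OneForm 𝓘(ℝ, EN) (LinkedPair R) EH),
      (∀ i, Apot i = potential 𝓘(ℝ, EM) 𝓘(ℝ, EG) (θP i)) →
      (∀ i, ηfull i = potential 𝓘(ℝ, EN) X.arrowModel (θQ i)) →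
      (∀ i, η i = OneForm.partH (ηfull i)) →
      (∀ i, ∀ n ∈ pairsIn R (U i), ∀ v : TangentSpace 𝓘(ℝ, EN) n,
        ηfull i n v = (η i n v, OneForm.atSource (Apot i) n v)) ∧
      (∀ i j, ∀ n ∈ pairsIn R (U i ∩ U j), ∀ v : TangentSpace 𝓘(ℝ, EN) n,
        X.αAct (g i j n.x) (η j n v)
          = lieAd 𝓘(ℝ, EH) (h i j n.y n.x)⁻¹ (η i n v)
            + invMulD 𝓘(ℝ, EN) 𝓘(ℝ, EH) (fun m : LinkedPair R => h i j m.y m.x) n v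
            + X.invMulαLie (h i j n.y n.x) (OneForm.atSource (Apot i) n v))) ∧
    -- the general case
    (∀ {EK : Type*} [NormedAddCommGroup EK] [NormedSpace ℝ EK] [FiniteDimensional ℝ EK]
        [ChartedSpace EK (G ⧸ X.t.range)] [LieGroup 𝓘(ℝ, EK) ∞ (G ⧸ X.t.range)],
      X.IsQuotientLieGroup (EK := EK) →
      ∀ (θP : ι → OneForm (𝓘(ℝ, EM).prod 𝓘(ℝ, EG)) (M × G) EG)
        (θQ : ι → OneForm (𝓘(ℝ, EN).prod X.arrowModel) (LinkedPair R × X.ArrowGroup) (EH × EG))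
        (θR : ι → OneForm (𝓘(ℝ, EM).prod 𝓘(ℝ, EK)) (M × (G ⧸ X.t.range)) EK),
      IsTwoConnection 𝓜 U g θP θQ θR →
      ∀ (Apot : ι → OneForm 𝓘(ℝ, EM) M EG)
        (ηfull : ι → OneForm 𝓘(ℝ, EN) (LinkedPair R) (EH × EG)),
      (∀ i, Apot i = potential 𝓘(ℝ, EM) 𝓘(ℝ, EG) (θP i)) →
      (∀ i, ηfull i = potential 𝓘(ℝ, EN) X.arrowModel (θQ i)) →
      ∀ (i j : ι) (ηij : OneForm 𝓘(ℝ, EM) M EH),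
      IsPotentialTransformation X (U i ∩ U j) (g i j) (Apot i) (Apot j) ηij →
      ∃ ζ : OneForm 𝓘(ℝ, EN) (LinkedPair R) EH,
        -- `ζ` takes its values in the kernel of `t^Lie` and vanishes along the diagonal
        (∀ n ∈ pairsIn R (U i ∩ U j), ∀ v : TangentSpace 𝓘(ℝ, EN) n, X.tLie (ζ n v) = 0) ∧
        (∀ x ∈ U i ∩ U j, ∀ w : TangentSpace 𝓘(ℝ, EM) x,
          ζ (𝓜.diag x) (mfderiv 𝓘(ℝ, EM) 𝓘(ℝ, EN) 𝓜.diag x w) = 0) ∧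
        ∀ n ∈ pairsIn R (U i ∩ U j), ∀ v : TangentSpace 𝓘(ℝ, EN) n,
          ηfull j n v
            = lieAd X.arrowModel (qTransition R X g h i j n)⁻¹ (ηfull i n v)
              + invMulD 𝓘(ℝ, EN) X.arrowModel (qTransition R X g h i j) n v
              + (0, X.tLie (OneForm.atSource ηij n v))
              + (OneForm.atTarget ηij n v - OneForm.atSource ηij n v, 0)
              + (ζ n v, 0)) := by

  refine ⟨?_, ?_⟩
  · rintro - θP θQ hθ Apot ηfull η hA hηfull hη
    obtain rfl : Apot = fun i => potential 𝓘(ℝ, EM) 𝓘(ℝ, EG) (θP i) := funext hA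
    obtain rfl : ηfull = fun i => potential 𝓘(ℝ, EN) X.arrowModel (θQ i) := funext hηfull
    have hsnd : ∀ i, ∀ n ∈ pairsIn R (U i), ∀ v : EN,
        (potential 𝓘(ℝ, EN) X.arrowModel (θQ i) n v : EH × EG).2
          = OneForm.atSource (potential 𝓘(ℝ, EM) 𝓘(ℝ, EG) (θP i)) n v := fun i n hn v =>
      (hθ.compatible i).potential_snd (hθ.connP.isConnection i) (hθ.connQ.isConnection i) hn v
    refine ⟨fun i n hn v => ?_, fun i j n hn v => ?_⟩
    · rw [hη i]
      exact Prod.ext rfl (hsnd i n hn v)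
    · have hni : n ∈ pairsIn R (U i) := ⟨hn.1.1, hn.2.1⟩
      have hnj : n ∈ pairsIn R (U j) := ⟨hn.1.2, hn.2.2⟩
      have hglue := hθ.connQ.potential_eq ⟨hni, hnj⟩ (hgh.mdifferentiableAt_q hU hn) v
      have hAd := X.αAct_lieAd_inv (h i j n.y n.x) (g i j n.x)
        (potential 𝓘(ℝ, EN) X.arrowModel (θQ i) n v)
      have hdq := X.αAct_invMulD (hgh.mdifferentiableAt_h hU hn) (hgh.mdifferentiableAt_g_x hU hn) v
      rw [hsnd i n hni v] at hAd
      have hsum := congrArg (fun Z : EH × EG => X.αAct (g i j n.x) Z.1) hglue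
      rw [hη i, hη j]
      refine hsum.trans ((map_add (X.αAct (g i j n.x)) _ _).trans ?_)
      refine (congrArg₂ (· + ·) hAd hdq).trans ?_
      exact add_right_comm _ _ _
  · intro EK _ _ _ _ _ _ θP θQ θR hθ Apot ηfull hA hηfull i j ηij hηij
    obtain rfl : Apot = fun i => potential 𝓘(ℝ, EM) 𝓘(ℝ, EG) (θP i) := funext hA
    obtain rfl : ηfull = fun i => potential 𝓘(ℝ, EN) X.arrowModel (θQ i) := funext hηfull
    -- `ρ` is the gauge transform of the potential on pairs in the trivialization `i` by `q^{ij}`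
    let ρ : OneForm 𝓘(ℝ, EN) (LinkedPair R) (EH × EG) := fun n =>
      (lieAd X.arrowModel (qTransition R X g h i j n)⁻¹).comp
          (potential 𝓘(ℝ, EN) X.arrowModel (θQ i) n)
        + invMulD 𝓘(ℝ, EN) X.arrowModel (qTransition R X g h i j) n
    have hρ : ∀ (n : LinkedPair R) (v : EN), ρ n v
      = lieAd X.arrowModel (qTransition R X g h i j n)⁻¹
          (potential 𝓘(ℝ, EN) X.arrowModel (θQ i) n v)
        + invMulD 𝓘(ℝ, EN) X.arrowModel (qTransition R X g h i j) n v := fun n v => rfl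
    let ζ : OneForm 𝓘(ℝ, EN) (LinkedPair R) EH := fun n =>
      (ContinuousLinearMap.fst ℝ EH EG).comp (potential 𝓘(ℝ, EN) X.arrowModel (θQ j) n - ρ n)
        - (OneForm.atTarget ηij n - OneForm.atSource ηij n)
    have hζ : ∀ (n : LinkedPair R) (v : EN), ζ n v
      = (potential 𝓘(ℝ, EN) X.arrowModel (θQ j) n v : EH × EG).1 - (ρ n v).1
        - (OneForm.atTarget ηij n v - OneForm.atSource ηij n v) := fun n v => rfl
    have hcompat := hθ.compatible
    -- comparison of the `𝔤`-components, by the potential-transformation law at `x`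
    have hsnd : ∀ n ∈ pairsIn R (U i ∩ U j), ∀ v : EN,
        (potential 𝓘(ℝ, EN) X.arrowModel (θQ j) n v : EH × EG).2
          = (ρ n v).2 + X.tLie (OneForm.atSource ηij n v) := by
      intro n hn v
      have hi := (hcompat i).potential_snd (hθ.connP i) (hθ.connQ i) ⟨hn.1.1, hn.2.1⟩ v
      have hj := (hcompat j).potential_snd (hθ.connP j) (hθ.connQ j) ⟨hn.1.2, hn.2.2⟩ v
      have hAd := modelDeriv_hom_lieAd X.right X.mdifferentiable_right (fun _ _ => rfl)
        (qTransition R X g h i j n)⁻¹ (potential 𝓘(ℝ, EN) X.arrowModel (θQ i) n v)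
      rw [X.modelDeriv_right, X.modelDeriv_right, hi] at hAd
      rw [hj, hρ, Prod.snd_add, hAd, hgh.invMulD_q_snd hU hn]
      exact hηij.eq n.x hn.2 (modelDeriv 𝓘(ℝ, EN) 𝓘(ℝ, EM) LinkedPair.x n v)
    -- comparison of the images under `(h, g) ↦ t(h) g`, by the potential-transformation law at `y`
    have htgt : ∀ n ∈ pairsIn R (U i ∩ U j), ∀ v : EN,
        modelDeriv X.arrowModel 𝓘(ℝ, EG) X.targetHom 1
            (potential 𝓘(ℝ, EN) X.arrowModel (θQ j) n v)
          = modelDeriv X.arrowModel 𝓘(ℝ, EG) X.targetHom 1 (ρ n v)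
            + X.tLie (OneForm.atTarget ηij n v) := by
      intro n hn v
      have hi := (hcompat i).targetHom_potential (hθ.connP i) (hθ.connQ i) ⟨hn.1.1, hn.2.1⟩ v
      have hj := (hcompat j).targetHom_potential (hθ.connP j) (hθ.connQ j) ⟨hn.1.2, hn.2.2⟩ v
      have hinv : X.targetHom (qTransition R X g h i j n)⁻¹ = (g i j n.y)⁻¹ := by
        rw [← hgh.targetHom_q hn]
        exact map_inv (MonoidHom.mk' X.targetHom X.targetHom_mul) _
      rw [hj, hρ, map_add, modelDeriv_hom_lieAd X.targetHom X.mdifferentiable_targetHom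
        X.targetHom_mul, hi, hinv, hgh.targetHom_invMulD_q hU hn]
      exact hηij.eq n.y hn.1 (modelDeriv 𝓘(ℝ, EN) 𝓘(ℝ, EM) LinkedPair.y n v)
    refine ⟨ζ, fun n hn (v : EN) => ?_, fun x hx (w : EM) => ?_, fun n hn (v : EN) => ?_⟩
    · have h1 := hsnd n hn v
      have h2 := htgt n hn v
      rw [X.modelDeriv_targetHom, X.modelDeriv_targetHom, h1] at h2
      rw [hζ, map_sub, map_sub, map_sub]
      refine Eq.trans ?_ (sub_eq_zero.2 h2)
      abel
    · have hi := (hcompat i).potential_diag (hθ.connP i) (hθ.connQ i) hx.1 w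
      have hj := (hcompat j).potential_diag (hθ.connP j) (hθ.connQ j) hx.2 w
      have hη : OneForm.atTarget ηij (𝓜.diag x) (modelDeriv 𝓘(ℝ, EM) 𝓘(ℝ, EN) 𝓜.diag x w)
          = OneForm.atSource ηij (𝓜.diag x) (modelDeriv 𝓘(ℝ, EM) 𝓘(ℝ, EN) 𝓜.diag x w) :=
        (congrArg (fun u : EM => ηij x u) (𝓜.modelDeriv_y_diag x w)).trans
          (congrArg (fun u : EM => ηij x u) (𝓜.modelDeriv_x_diag x w)).symm
      refine (hζ (𝓜.diag x) (modelDeriv 𝓘(ℝ, EM) 𝓘(ℝ, EN) 𝓜.diag x w)).trans ?_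
      rw [hρ, hi, hj, Prod.fst_add, hgh.lieAd_q_diag hx, hgh.invMulD_q_diag hU hx, hη]
      simp
    · have h1 := hsnd n hn v
      refine Prod.ext ?_ ?_
      · change (potential 𝓘(ℝ, EN) X.arrowModel (θQ j) n v : EH × EG).1 = (ρ n v).1 + 0
          + (OneForm.atTarget ηij n v - OneForm.atSource ηij n v) + ζ n v
        rw [hζ]
        abel
      · refine h1.trans ?_
        change _ = (ρ n v).2 + X.tLie (OneForm.atSource ηij n v) + 0 + 0
        rw [add_zero, add_zero]
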